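/- Let $\omega\in(0,2\pi]$ and let $\Omega=\{(r\cos\varphi,r\sin\varphi)\in\mathbb R^2: 0<r<1,\ 0<\varphi<\omega\}$ be the circular sector of angle $\omega$. Let $k\in\mathbb N_0$, $m\in\mathbb N=\{1,2,\dots\}$, $\nu_k=k\pi/\omega$, let $J_{\nu}(x)=\sum_{j\ge 0}\frac{(-1)^j}{j!\,\Gamma(\nu+j+1)}\left(\frac x2\right)^{2j+\nu}$ be the Bessel function of the first kind, and let $\mu_{\nu_k,m}$ be the $m$-th positive zero of $J_{\nu_k}$. Then the Laplace eigenfunction of the sector, given in polar coordinates by $$u_{\nu_k,m}(r,\varphi)=J_{\nu_k}(\mu_{\nu_k,m}\,r)\cos(\nu_k\varphi),$$ satisfies $$u_{\nu_k,m}\in H^s(\Omega)\qquad\text{for all } s\ge 0 \text{ with } s<\nu_k+1 .$$ Here, for $s=n+\sigma$ with $n=\lfloor s\rfloor$ and $\sigma\in[0,1)$, the Sobolev(–Slobodeckij) space $H^s(\Omega)$ consists of the functions $u$ whose weak derivatives $D^\alpha u$, $|\alpha|\le n$, exist and lie in $L^2(\Omega)$ and, if $\sigma>0$, satisfy $$\int_\Omega\int_\Omega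 \frac{|D^\alpha u(x)-D^\alpha u(y)|^2}{d(x,y)^{2+2\sigma}}\,dy\,dx<\infty\qquad(|\alpha|=n),$$ where $d(x,y)=|x-y|$, except that in the case of the slit disc $\omega=2\pi$ with $k$ odd and $\sigma\ge\tfrac12$, $d(x,y)$ is the inner distance of $\Omega$, i.e. the infimum of the lengths of the paths in $\Omega$ from $x$ to $y$. (In all cases the membership also holds with the inner distance as $d$.) -/

import Mathlib

open scoped ENNReal

noncomputable section

/-- The Bessel function of the first kind of real order `ν`, by its series. -/
def besselJ (ν x : ℝ) : ℝ :=
  ∑' j : ℕ, (-1 : ℝ) ^ j / ((j.factorial : ℝ) * Real.Gamma (ν + j + 1)) *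
    (x / 2) ^ (2 * (j : ℝ) + ν)

/-- `μ` is the `m`-th positive zero (`m = 1, 2, …`) of the Bessel function `J_ν`. -/
def IsBesselZero (ν : ℝ) (m : ℕ) (μ : ℝ) : Prop :=
  0 < μ ∧ besselJ ν μ = 0 ∧
    {x : ℝ | 0 < x ∧ x ≤ μ ∧ besselJ ν x = 0}.Finite ∧
    {x : ℝ | 0 < x ∧ x ≤ μ ∧ besselJ ν x = 0}.ncard = m

/-- The open circular sector of radius `1` and angle `ω`. -/
def sector (ω : ℝ) : Set (EuclideanSpace ℝ (Fin 2)) :=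
  {x | ∃ r φ : ℝ, 0 < r ∧ r < 1 ∧ 0 < φ ∧ φ < ω ∧ x = !₂[r * Real.cos φ, r * Real.sin φ]}

/-- The polar angle of a point of the plane, taken in `[0, 2π)`. -/
def polarAngle (x : EuclideanSpace ℝ (Fin 2)) : ℝ :=
  toIcoMod Real.two_pi_pos 0 (Complex.arg ⟨x 0, x 1⟩)

/-- The function `J_ν(μ r) cos(ν φ)` of the polar coordinates `(r, φ)`, as a function on the
plane. -/
def eigenmode (ν μ : ℝ) (x : EuclideanSpace ℝ (Fin 2)) : ℝ :=
  besselJ ν (μ * ‖x‖) * Real.cos (ν * polarAngle x)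

/-- The defining formula of `eigenmode` in polar coordinates. -/
theorem eigenmode_polar (ν μ r φ : ℝ) (hr : 0 < r) (hφ : 0 ≤ φ) (hφ' : φ < 2 * Real.pi) :
    eigenmode ν μ !₂[r * Real.cos φ, r * Real.sin φ] =
      besselJ ν (μ * r) * Real.cos (ν * φ) := by
  have h1 : ‖(!₂[r * Real.cos φ, r * Real.sin φ] : EuclideanSpace ℝ (Fin 2))‖ = r := by
    rw [EuclideanSpace.norm_eq, Real.sqrt_eq_iff_mul_self_eq (by positivity) hr.le]
    simp only [Fin.sum_univ_two, Real.norm_eq_abs, sq_abs]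
    simp
    nlinarith [Real.sin_sq_add_cos_sq φ]
  have h2 : polarAngle !₂[r * Real.cos φ, r * Real.sin φ] = φ := by
    have e : (⟨r * Real.cos φ, r * Real.sin φ⟩ : ℂ) =
        r * (Complex.cos φ + Complex.sin φ * Complex.I) := by
      apply Complex.ext <;> simp [Complex.cos_ofReal_re, Complex.sin_ofReal_re]
    have h3 : polarAngle !₂[r * Real.cos φ, r * Real.sin φ] =
        toIcoMod Real.two_pi_pos 0 (Complex.arg ⟨r * Real.cos φ, r * Real.sin φ⟩) := by
      simp [polarAngle]
    rw [h3, e, Complex.arg_mul_cos_add_sin_mul_I_eq_toIocMod hr, toIcoMod_toIocMod,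
      toIcoMod_eq_self]
    exact ⟨hφ, by simpa using hφ'⟩
  rw [eigenmode, h1, h2]

/-- The partial derivative in the `i`-th Cartesian coordinate. -/
def partialDeriv (i : Fin 2) (f : EuclideanSpace ℝ (Fin 2) → ℝ) :
    EuclideanSpace ℝ (Fin 2) → ℝ :=
  fun x => fderiv ℝ f x (EuclideanSpace.single i 1)

/-- The classical derivative `D^α f` for a multi-index `α`. -/
def multiDeriv (α : Fin 2 → ℕ) (f : EuclideanSpace ℝ (Fin 2) → ℝ) :
    EuclideanSpace ℝ (Fin 2) → ℝ :=
  (partialDeriv 0)^[α 0] ((partialDeriv 1)^[α 1] f)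

/-- `v` is the weak derivative `D^α u` on the open set `Ω`. -/
def IsWeakDeriv (Ω : Set (EuclideanSpace ℝ (Fin 2))) (α : Fin 2 → ℕ)
    (u v : EuclideanSpace ℝ (Fin 2) → ℝ) : Prop :=
  MeasureTheory.LocallyIntegrableOn u Ω ∧ MeasureTheory.LocallyIntegrableOn v Ω ∧
    ∀ ψ : EuclideanSpace ℝ (Fin 2) → ℝ, ContDiff ℝ (⊤ : ℕ∞) ψ → HasCompactSupport ψ → tsupport ψ ⊆ Ω →
      ∫ x in Ω, u x * multiDeriv α ψ x = (-1) ^ (α 0 + α 1) * ∫ x in Ω, v x * ψ x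

/-- The square of the Slobodeckij seminorm of order `σ` on `Ω` (in dimension `2`), formed with the
distance function `d`. -/
def slobodeckijSq (d : EuclideanSpace ℝ (Fin 2) → EuclideanSpace ℝ (Fin 2) → ℝ≥0∞)
    (Ω : Set (EuclideanSpace ℝ (Fin 2))) (σ : ℝ) (v : EuclideanSpace ℝ (Fin 2) → ℝ) : ℝ≥0∞ :=
  ∫⁻ x in Ω, ∫⁻ y in Ω, ‖v x - v y‖ₑ ^ 2 / d x y ^ (2 + 2 * σ)

/-- `u ∈ H^s(Ω)` for an open set `Ω` and `s ≥ 0`, the Slobodeckij seminorms being formed with the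
distance function `d`. With `n = ⌊s⌋`, all weak derivatives of order at most `n` exist and
are square integrable, and, if `s` is not an integer, those of order `n` have a finite Slobodeckij
seminorm of order `s - n`. The usual space is the case `d = edist`. -/
def MemSobolev (d : EuclideanSpace ℝ (Fin 2) → EuclideanSpace ℝ (Fin 2) → ℝ≥0∞)
    (Ω : Set (EuclideanSpace ℝ (Fin 2))) (s : ℝ) (u : EuclideanSpace ℝ (Fin 2) → ℝ) : Prop :=
  ∃ g : (Fin 2 → ℕ) → EuclideanSpace ℝ (Fin 2) → ℝ, ∀ α : Fin 2 → ℕ, α 0 + α 1 ≤ ⌊s⌋₊ →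
    IsWeakDeriv Ω α u (g α) ∧
    MeasureTheory.MemLp (g α) 2 (MeasureTheory.volume.restrict Ω) ∧
    (α 0 + α 1 = ⌊s⌋₊ → (⌊s⌋₊ : ℝ) < s → slobodeckijSq d Ω (s - ⌊s⌋₊) (g α) < ⊤)

/-- The inner distance of `Ω`: the infimum of the lengths of the paths in `Ω` from `x` to `y`. -/
def innerEDist (Ω : Set (EuclideanSpace ℝ (Fin 2))) (x y : EuclideanSpace ℝ (Fin 2)) : ℝ≥0∞ :=
  ⨅ (γ : Path x y) (_ : ∀ t, γ t ∈ Ω), eVariationOn γ Set.univ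

end

/-! The series of `J_ν` is `(x/2)^ν` times an entire function of `x²`, and `r^ν cos(νφ)` is the real
part of `z^ν`. Hence the eigenmode is `Re(z^ν H)` with `H` smooth on the whole plane, and every
derivative of order `n` has the same shape with exponent `β = ν - n`
(`exists_partialDeriv_powMode`). Such a function is `O(r^β)` with gradient `O(r^(β-1))`. It is
square integrable for `β > -1`, and its classical derivatives are weak ones because test functions
avoid the boundary.

For the seminorm of order `σ`, pairs of points are compared with their distance to the origin. If
the inner distance is small against `‖x‖`, the gradient is integrated along a short path; otherwise
the values alone suffice. Both cases give the bound `(w x + w y) * ‖x - y‖^(-a)` with `w = r^(2b-q)`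
and `a + q = 2 + 2σ`, where `b = min β 0`; it is integrable for `2σ < q < 2b + 2`
(`enorm_sq_div_innerEDist_le`, `slobodeckijSq_lt_top`). Such a `q` exists because `σ < β + 1` and `σ
< 1`.

This settles the inner distance. For `ω < 2π` the Euclidean distance is equivalent to it. On the
slit disc there are two substitutes: for even `k` the power `z^ν` is a polynomial, and for `σ < 1/2`
the jump across the slit is harmless, since two points on opposite sides are at least as far apart
as each is from the axis, which costs only an integrable weight `|x 1|^(-q)` with `q < 1`. -/

noncomputable section

/-! ### Real powers of `z` on the slit plane -/

/-- The isometric identification of the Euclidean plane with `ℂ`. -/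
def toComplex : EuclideanSpace ℝ (Fin 2) ≃ₗᵢ[ℝ] ℂ :=
  Complex.orthonormalBasisOneI.repr.symm

theorem toComplex_apply (x : EuclideanSpace ℝ (Fin 2)) :
    toComplex x = x 0 + x 1 * Complex.I :=
  Complex.orthonormalBasisOneI_repr_symm_apply x

theorem toComplex_re (x : EuclideanSpace ℝ (Fin 2)) : (toComplex x).re = x 0 := by
  simp [toComplex_apply]

theorem toComplex_im (x : EuclideanSpace ℝ (Fin 2)) : (toComplex x).im = x 1 := by
  simp [toComplex_apply]

/-- The plane cut along the nonnegative real axis. -/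
def slitDomain : Set (EuclideanSpace ℝ (Fin 2)) :=
  {x | -toComplex x ∈ Complex.slitPlane}

theorem isOpen_slitDomain : IsOpen slitDomain :=
  Complex.isOpen_slitPlane.preimage (by fun_prop : Continuous fun x => -toComplex x)

/-- The power `z ^ β`, with the branch `arg z ∈ (0, 2π)`. -/
def branchPow (β : ℝ) (x : EuclideanSpace ℝ (Fin 2)) : ℂ :=
  Complex.exp (β * (Complex.log (-toComplex x) + Real.pi * Complex.I))

theorem toComplex_ne_zero {x : EuclideanSpace ℝ (Fin 2)} (hx : x ∈ slitDomain) :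
    toComplex x ≠ 0 := by
  intro h
  have := Complex.slitPlane_ne_zero hx
  simp [h] at this

theorem norm_pos_of_mem_slitDomain {x : EuclideanSpace ℝ (Fin 2)} (hx : x ∈ slitDomain) :
    0 < ‖x‖ := by
  rw [← toComplex.norm_map]
  exact norm_pos_iff.2 (toComplex_ne_zero hx)

theorem norm_branchPow (β : ℝ) {x : EuclideanSpace ℝ (Fin 2)} (hx : x ∈ slitDomain) :
    ‖branchPow β x‖ = ‖x‖ ^ β := by
  rw [branchPow, Complex.norm_exp, Real.rpow_def_of_pos (norm_pos_of_mem_slitDomain hx)]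
  simp [Complex.log_re, toComplex.norm_map, mul_comm]

/-- The added `πi` compensates the sign in `-z`, so the expression multiplied by `β` is a logarithm
of `z` itself. -/
theorem branchPow_sub_one_mul (β : ℝ) {x : EuclideanSpace ℝ (Fin 2)} (hx : x ∈ slitDomain) :
    branchPow (β - 1) x * toComplex x = branchPow β x := by
  have h : Complex.exp (Complex.log (-toComplex x) + Real.pi * Complex.I) = toComplex x := by
    rw [Complex.exp_add, Complex.exp_log (Complex.slitPlane_ne_zero hx), Complex.exp_pi_mul_I]
    ring
  calc branchPow (β - 1) x * toComplex x
      = branchPow (β - 1) x * Complex.exp (Complex.log (-toComplex x) + Real.pi * Complex.I) := by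
        rw [h]
    _ = branchPow β x := by
      rw [branchPow, branchPow, ← Complex.exp_add]
      congr 1
      push_cast
      ring

theorem hasFDerivAt_branchPow (β : ℝ) {x : EuclideanSpace ℝ (Fin 2)} (hx : x ∈ slitDomain) :
    HasFDerivAt (branchPow β)
      ((β * branchPow (β - 1) x) •
        (toComplex.toContinuousLinearEquiv : EuclideanSpace ℝ (Fin 2) →L[ℝ] ℂ)) x := by
  have hz := toComplex_ne_zero hx
  have h1 : HasDerivAt
      (fun z : ℂ => Complex.exp (β * (Complex.log (-z) + Real.pi * Complex.I)))
      (β * branchPow (β - 1) x) (toComplex x) := by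
    have h2 : HasDerivAt (fun z : ℂ => Complex.log (-z)) ((-1) / (-toComplex x)) (toComplex x) :=
      (hasDerivAt_neg _).clog hx
    have h3 := ((h2.add_const (Real.pi * Complex.I)).const_mul (β : ℂ)).cexp
    refine h3.congr_deriv ?_
    change branchPow β x * _ = _
    rw [← branchPow_sub_one_mul β hx]
    field_simp
  have h4 : HasFDerivAt toComplex
      (toComplex.toContinuousLinearEquiv : EuclideanSpace ℝ (Fin 2) →L[ℝ] ℂ) x :=
    toComplex.toContinuousLinearEquiv.hasFDerivAt
  exact h1.comp_hasFDerivAt x h4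

theorem contDiffOn_branchPow (β : ℝ) :
    ContDiffOn ℝ (⊤ : ℕ∞) (branchPow β) slitDomain := by
  intro x hx
  apply ContDiffAt.contDiffWithinAt
  have h1 : ContDiffAt ℂ (⊤ : ℕ∞) Complex.log (-toComplex x) := Complex.contDiffAt_log hx
  have h2 : ContDiffAt ℝ (⊤ : ℕ∞) Complex.log (-toComplex x) := h1.restrict_scalars ℝ
  have h3 : ContDiffAt ℝ (⊤ : ℕ∞) (fun y => -toComplex y) x :=
    (toComplex.contDiff.neg).contDiffAt
  have h4 : ContDiffAt ℝ (⊤ : ℕ∞) (fun y => Complex.log (-toComplex y)) x :=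
    ContDiffAt.comp (g := Complex.log) x h2 h3
  have h5 : ContDiffAt ℝ (⊤ : ℕ∞)
      (fun y => (β : ℂ) * (Complex.log (-toComplex y) + Real.pi * Complex.I)) x :=
    contDiffAt_const.mul (h4.add contDiffAt_const)
  exact h5.cexp

/-! ### The functions `Re(z^β H)`: derivatives and growth at the origin -/

/-- The real part of `z ^ β H`, the shape which all derivatives of the eigenmode take. -/
def powMode (β : ℝ) (H : EuclideanSpace ℝ (Fin 2) → ℂ) (x : EuclideanSpace ℝ (Fin 2)) : ℝ :=
  (branchPow β x * H x).re

theorem contDiffOn_powMode (β : ℝ) {H : EuclideanSpace ℝ (Fin 2) → ℂ}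
    (hH : ContDiff ℝ (⊤ : ℕ∞) H) : ContDiffOn ℝ (⊤ : ℕ∞) (powMode β H) slitDomain :=
  Complex.reCLM.contDiff.comp_contDiffOn ((contDiffOn_branchPow β).mul hH.contDiffOn)

theorem hasFDerivAt_powMode (β : ℝ) {H : EuclideanSpace ℝ (Fin 2) → ℂ}
    (hH : ContDiff ℝ (⊤ : ℕ∞) H) {x : EuclideanSpace ℝ (Fin 2)} (hx : x ∈ slitDomain) :
    HasFDerivAt (powMode β H) (Complex.reCLM.comp (branchPow β x • fderiv ℝ H x +
      H x • ((β * branchPow (β - 1) x) •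
        (toComplex.toContinuousLinearEquiv : EuclideanSpace ℝ (Fin 2) →L[ℝ] ℂ)))) x := by
  have h1 : HasFDerivAt H (fderiv ℝ H x) x := (hH.differentiable (by simp) x).hasFDerivAt
  exact Complex.reCLM.hasFDerivAt.comp x ((hasFDerivAt_branchPow β hx).mul h1)

/-- Pulling one factor `z` out of `z^β` gives `∂(z^β H) = z^(β-1) (z ∂H + β e H)`, with `e = 1` or
`e = i` the direction, so the class is stable under differentiation. -/
theorem exists_partialDeriv_powMode (i : Fin 2) (β : ℝ) {H : EuclideanSpace ℝ (Fin 2) → ℂ}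
    (hH : ContDiff ℝ (⊤ : ℕ∞) H) : ∃ H' : EuclideanSpace ℝ (Fin 2) → ℂ,
      ContDiff ℝ (⊤ : ℕ∞) H' ∧
        Set.EqOn (partialDeriv i (powMode β H)) (powMode (β - 1) H') slitDomain := by
  refine ⟨fun x => toComplex x * fderiv ℝ H x (EuclideanSpace.single i 1) +
    β * toComplex (EuclideanSpace.single i 1) * H x, ?_, ?_⟩
  · have h1 : ContDiff ℝ (⊤ : ℕ∞) (fderiv ℝ H) := hH.fderiv_right (by simp)
    have h2 : ContDiff ℝ (⊤ : ℕ∞) (fun x => fderiv ℝ H x (EuclideanSpace.single i 1)) :=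
      h1.clm_apply contDiff_const
    exact (toComplex.contDiff.mul h2).add (contDiff_const.mul hH)
  · intro x hx
    rw [partialDeriv, (hasFDerivAt_powMode β hH hx).fderiv, powMode]
    simp only [ContinuousLinearMap.comp_apply, Complex.reCLM_apply]
    congr 1
    simp only [add_apply, smul_apply, smul_eq_mul]
    rw [← branchPow_sub_one_mul β hx]
    change _ + H x * (β * branchPow (β - 1) x * toComplex _) = _
    ring

theorem exists_bound_powMode (β : ℝ) {H : EuclideanSpace ℝ (Fin 2) → ℂ}
    (hH : ContDiff ℝ (⊤ : ℕ∞) H) : ∃ C : ℝ, 0 ≤ C ∧ ∀ x ∈ slitDomain, ‖x‖ ≤ 1 →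
      |powMode β H x| ≤ C * ‖x‖ ^ β ∧ ‖fderiv ℝ (powMode β H) x‖ ≤ C * ‖x‖ ^ (β - 1) := by
  have hd : Continuous (fderiv ℝ H) := hH.continuous_fderiv (by simp)
  obtain ⟨A, hA⟩ := (isCompact_closedBall (0 : EuclideanSpace ℝ (Fin 2)) 1).exists_bound_of_continuousOn
    hH.continuous.continuousOn
  obtain ⟨B, hB⟩ := (isCompact_closedBall (0 : EuclideanSpace ℝ (Fin 2)) 1).exists_bound_of_continuousOn
    hd.continuousOn
  have hA0 : 0 ≤ A := (norm_nonneg _).trans (hA 0 (by simp))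
  have hB0 : 0 ≤ B := (norm_nonneg _).trans (hB 0 (by simp))
  refine ⟨A + B + A * |β|, by positivity, fun x hx hx1 => ?_⟩
  have hr := norm_pos_of_mem_slitDomain hx
  have hxA := hA x (by simpa using hx1)
  have hxB := hB x (by simpa using hx1)
  constructor
  · calc |powMode β H x| ≤ ‖branchPow β x * H x‖ := Complex.abs_re_le_norm _
      _ = ‖x‖ ^ β * ‖H x‖ := by rw [norm_mul, norm_branchPow β hx]
      _ ≤ ‖x‖ ^ β * (A + B + A * |β|) := by
        gcongr
        have : 0 ≤ A * |β| := by positivity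
        linarith
      _ = _ := mul_comm _ _
  · rw [(hasFDerivAt_powMode β hH hx).fderiv]
    refine ContinuousLinearMap.opNorm_le_bound _ (by positivity) fun y => ?_
    -- The term containing `∂H` is less singular; in the unit disc it is absorbed by the other one.
    have h1 : ‖x‖ ^ β ≤ ‖x‖ ^ (β - 1) :=
      Real.rpow_le_rpow_of_exponent_ge hr hx1 (by linarith)
    have h2 : ‖fderiv ℝ H x y‖ ≤ B * ‖y‖ :=
      ((fderiv ℝ H x).le_opNorm y).trans (by gcongr)
    have e : (Complex.reCLM.comp (branchPow β x • fderiv ℝ H x +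
      H x • ((β * branchPow (β - 1) x) •
        (toComplex.toContinuousLinearEquiv : EuclideanSpace ℝ (Fin 2) →L[ℝ] ℂ)))) y =
        (branchPow β x * fderiv ℝ H x y + H x * (β * branchPow (β - 1) x * toComplex y)).re := rfl
    rw [e]
    calc _ ≤ ‖branchPow β x * fderiv ℝ H x y +
            H x * (β * branchPow (β - 1) x * toComplex y)‖ := Complex.abs_re_le_norm _
      _ ≤ ‖branchPow β x * fderiv ℝ H x y‖ +
            ‖H x * (β * branchPow (β - 1) x * toComplex y)‖ := norm_add_le _ _
      _ = ‖x‖ ^ β * ‖fderiv ℝ H x y‖ + ‖H x‖ * (|β| * ‖x‖ ^ (β - 1) * ‖y‖) := by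
        simp [norm_branchPow _ hx, toComplex.norm_map]
      _ ≤ ‖x‖ ^ (β - 1) * (B * ‖y‖) + A * (|β| * ‖x‖ ^ (β - 1) * ‖y‖) := by gcongr
      _ ≤ (A + B + A * |β|) * ‖x‖ ^ (β - 1) * ‖y‖ := by
        have : 0 ≤ A * ‖x‖ ^ (β - 1) * ‖y‖ := by positivity
        linarith

/-! ### Iterated partial derivatives -/

theorem partialDeriv_congr {Ω : Set (EuclideanSpace ℝ (Fin 2))} (hΩ : IsOpen Ω) (i : Fin 2)
    {f g : EuclideanSpace ℝ (Fin 2) → ℝ} (h : Set.EqOn f g Ω) :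
    Set.EqOn (partialDeriv i f) (partialDeriv i g) Ω := by
  intro x hx
  rw [partialDeriv, partialDeriv, (h.eventuallyEq_of_mem (hΩ.mem_nhds hx)).fderiv_eq]

theorem partialDeriv_iterate_congr {Ω : Set (EuclideanSpace ℝ (Fin 2))} (hΩ : IsOpen Ω)
    (i : Fin 2) (n : ℕ) {f g : EuclideanSpace ℝ (Fin 2) → ℝ} (h : Set.EqOn f g Ω) :
    Set.EqOn ((partialDeriv i)^[n] f) ((partialDeriv i)^[n] g) Ω := by
  induction n with
  | zero => exact h
  | succ n ih =>
    simp only [Function.iterate_succ_apply']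
    exact partialDeriv_congr hΩ i ih

theorem exists_partialDeriv_iterate_powMode (i : Fin 2) (n : ℕ) (β : ℝ)
    {H : EuclideanSpace ℝ (Fin 2) → ℂ} (hH : ContDiff ℝ (⊤ : ℕ∞) H) :
    ∃ H' : EuclideanSpace ℝ (Fin 2) → ℂ, ContDiff ℝ (⊤ : ℕ∞) H' ∧
      Set.EqOn ((partialDeriv i)^[n] (powMode β H)) (powMode (β - n) H') slitDomain := by
  induction n with
  | zero => exact ⟨H, hH, by simp [Set.eqOn_refl]⟩
  | succ n ih =>
    obtain ⟨H₁, hH₁, h₁⟩ := ih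
    obtain ⟨H₂, hH₂, h₂⟩ := exists_partialDeriv_powMode i (β - n) hH₁
    refine ⟨H₂, hH₂, ?_⟩
    rw [Function.iterate_succ_apply', Nat.cast_succ, ← sub_sub]
    exact (partialDeriv_congr isOpen_slitDomain i h₁).trans h₂

theorem contDiff_partialDeriv (i : Fin 2) {f : EuclideanSpace ℝ (Fin 2) → ℝ}
    (hf : ContDiff ℝ (⊤ : ℕ∞) f) : ContDiff ℝ (⊤ : ℕ∞) (partialDeriv i f) :=
  (hf.fderiv_right (by simp) : ContDiff ℝ (⊤ : ℕ∞) (fderiv ℝ f)).clm_apply contDiff_const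

theorem contDiff_partialDeriv_iterate (i : Fin 2) (n : ℕ) {f : EuclideanSpace ℝ (Fin 2) → ℝ}
    (hf : ContDiff ℝ (⊤ : ℕ∞) f) : ContDiff ℝ (⊤ : ℕ∞) ((partialDeriv i)^[n] f) := by
  induction n with
  | zero => exact hf
  | succ n ih =>
    rw [Function.iterate_succ_apply']
    exact contDiff_partialDeriv i ih

theorem contDiffOn_partialDeriv {Ω : Set (EuclideanSpace ℝ (Fin 2))} (hΩ : IsOpen Ω) (i : Fin 2)
    {f : EuclideanSpace ℝ (Fin 2) → ℝ} (hf : ContDiffOn ℝ (⊤ : ℕ∞) f Ω) :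
    ContDiffOn ℝ (⊤ : ℕ∞) (partialDeriv i f) Ω :=
  (hf.fderiv_of_isOpen hΩ (by simp) : ContDiffOn ℝ (⊤ : ℕ∞) (fderiv ℝ f) Ω).clm_apply
    contDiffOn_const

theorem contDiffOn_partialDeriv_iterate {Ω : Set (EuclideanSpace ℝ (Fin 2))} (hΩ : IsOpen Ω)
    (i : Fin 2) (n : ℕ) {f : EuclideanSpace ℝ (Fin 2) → ℝ} (hf : ContDiffOn ℝ (⊤ : ℕ∞) f Ω) :
    ContDiffOn ℝ (⊤ : ℕ∞) ((partialDeriv i)^[n] f) Ω := by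
  induction n with
  | zero => exact hf
  | succ n ih =>
    rw [Function.iterate_succ_apply']
    exact contDiffOn_partialDeriv hΩ i ih

/-! ### Polar coordinates and the sector -/

theorem toComplex_polar (r φ : ℝ) :
    toComplex !₂[r * Real.cos φ, r * Real.sin φ] =
      r * (Complex.cos φ + Complex.sin φ * Complex.I) := by
  rw [toComplex_apply]
  simp
  ring

theorem neg_toComplex_polar (r φ : ℝ) :
    -toComplex !₂[r * Real.cos φ, r * Real.sin φ] =
      r * (Complex.cos (φ - Real.pi : ℝ) + Complex.sin (φ - Real.pi : ℝ) * Complex.I) := by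
  rw [toComplex_polar]
  push_cast
  rw [Complex.cos_sub_pi, Complex.sin_sub_pi]
  ring

theorem norm_polar {r : ℝ} (hr : 0 ≤ r) (φ : ℝ) :
    ‖(!₂[r * Real.cos φ, r * Real.sin φ] : EuclideanSpace ℝ (Fin 2))‖ = r := by
  rw [← toComplex.norm_map, toComplex_polar, norm_mul, Complex.norm_cos_add_sin_mul_I]
  simp [abs_of_nonneg hr]

theorem arg_neg_toComplex_polar {r φ : ℝ} (hr : 0 < r) (hφ : 0 < φ) (hφ' : φ < 2 * Real.pi) :
    Complex.arg (-toComplex !₂[r * Real.cos φ, r * Real.sin φ]) = φ - Real.pi := by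
  rw [neg_toComplex_polar, Complex.arg_mul_cos_add_sin_mul_I hr]
  constructor <;> linarith

theorem polar_mem_slitDomain {r φ : ℝ} (hr : 0 < r) (hφ : 0 < φ) (hφ' : φ < 2 * Real.pi) :
    !₂[r * Real.cos φ, r * Real.sin φ] ∈ slitDomain := by
  change -toComplex _ ∈ Complex.slitPlane
  rw [Complex.mem_slitPlane_iff_arg, arg_neg_toComplex_polar hr hφ hφ']
  refine ⟨by intro h; linarith, ?_⟩
  rw [neg_ne_zero, ← norm_ne_zero_iff, toComplex.norm_map, norm_polar hr.le]
  exact hr.ne'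

theorem eq_polar (x : EuclideanSpace ℝ (Fin 2)) :
    x = !₂[‖x‖ * Real.cos (Complex.arg (-toComplex x) + Real.pi),
      ‖x‖ * Real.sin (Complex.arg (-toComplex x) + Real.pi)] := by
  apply toComplex.injective
  rw [toComplex_polar]
  have h := Complex.norm_mul_cos_add_sin_mul_I (-toComplex x)
  rw [norm_neg, toComplex.norm_map] at h
  push_cast
  rw [Complex.cos_add_pi, Complex.sin_add_pi]
  linear_combination h

/-- The angle in `(0, 2π)` is `arg(-z) + π`, which is continuous on the slit plane; openness of the
sector follows from this form. -/
theorem mem_sector_iff {ω : ℝ} (hω : ω ≤ 2 * Real.pi) {x : EuclideanSpace ℝ (Fin 2)} :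
    x ∈ sector ω ↔
      x ∈ slitDomain ∧ ‖x‖ < 1 ∧ Complex.arg (-toComplex x) + Real.pi < ω := by
  constructor
  · rintro ⟨r, φ, hr, hr1, hφ, hφ', rfl⟩
    refine ⟨polar_mem_slitDomain hr hφ (by linarith), by rwa [norm_polar hr.le], ?_⟩
    rw [arg_neg_toComplex_polar hr hφ (by linarith)]
    linarith
  · rintro ⟨h1, h2, h3⟩
    exact ⟨‖x‖, _, norm_pos_of_mem_slitDomain h1, h2,
      by linarith [Complex.neg_pi_lt_arg (-toComplex x)], h3, eq_polar x⟩

theorem sector_subset_slitDomain {ω : ℝ} (hω : ω ≤ 2 * Real.pi) : sector ω ⊆ slitDomain :=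
  fun _ hx => ((mem_sector_iff hω).1 hx).1

theorem sector_subset_ball (ω : ℝ) :
    sector ω ⊆ Metric.ball (0 : EuclideanSpace ℝ (Fin 2)) 1 := by
  rintro _ ⟨r, φ, hr, hr1, -, -, rfl⟩
  rwa [mem_ball_zero_iff, norm_polar hr.le]

theorem isOpen_sector {ω : ℝ} (hω : ω ≤ 2 * Real.pi) : IsOpen (sector ω) := by
  have h1 : ContinuousOn (fun x => Complex.arg (-toComplex x) + Real.pi) slitDomain := by
    intro x hx
    refine ContinuousAt.continuousWithinAt (ContinuousAt.add ?_ continuousAt_const)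
    exact ContinuousAt.comp (g := Complex.arg) (Complex.continuousAt_arg hx)
      (by fun_prop : Continuous fun x => -toComplex x).continuousAt
  have h2 := (h1.isOpen_inter_preimage isOpen_slitDomain (isOpen_Iio (a := ω))).inter
    (Metric.isOpen_ball (x := (0 : EuclideanSpace ℝ (Fin 2))) (ε := 1))
  convert h2 using 1
  ext x
  rw [mem_sector_iff hω]
  simp only [Set.mem_inter_iff, Set.mem_preimage, Set.mem_Iio, mem_ball_zero_iff]
  tauto

theorem mem_sector_two_pi_iff {x : EuclideanSpace ℝ (Fin 2)} :
    x ∈ sector (2 * Real.pi) ↔ ‖x‖ < 1 ∧ (x 0 < 0 ∨ x 1 ≠ 0) := by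
  have hs : x ∈ slitDomain ↔ x 0 < 0 ∨ x 1 ≠ 0 := by
    change -toComplex x ∈ Complex.slitPlane ↔ _
    rw [Complex.mem_slitPlane_iff]
    simp [toComplex_re, toComplex_im]
  rw [mem_sector_iff le_rfl, ← hs]
  refine ⟨fun h => ⟨h.2.1, h.1⟩, fun h => ⟨h.2, h.1, ?_⟩⟩
  have h1 := (Complex.mem_slitPlane_iff_arg.1 h.2).1
  have h2 := lt_of_le_of_ne (Complex.arg_le_pi (-toComplex x)) h1
  linarith

/-! ### The Bessel series and the eigenmode as `Re(z^ν H)` -/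

/-- The coefficients of the entire function `t ↦ ∑ (-t) ^ j / (j! Γ (ν + j + 1))`. -/
def besselCoeff (ν : ℝ) (j : ℕ) : ℝ :=
  (-1 : ℝ) ^ j / ((j.factorial : ℝ) * Real.Gamma (ν + j + 1))

theorem besselCoeff_ne_zero {ν : ℝ} (hν : 0 ≤ ν) (j : ℕ) : besselCoeff ν j ≠ 0 := by
  have : 0 < Real.Gamma (ν + j + 1) := Real.Gamma_pos_of_pos (by positivity)
  have : (0 : ℝ) < j.factorial := by positivity
  exact div_ne_zero (by simp) (by positivity)

theorem norm_besselCoeff_ratio {ν : ℝ} (hν : 0 ≤ ν) (j : ℕ) :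
    ‖besselCoeff ν (j + 1)‖ / ‖besselCoeff ν j‖ = 1 / (((j : ℝ) + 1) * (ν + j + 1)) := by
  have hp : (0 : ℝ) < ν + j + 1 := by positivity
  have hG : 0 < Real.Gamma (ν + j + 1) := Real.Gamma_pos_of_pos hp
  have hf : (0 : ℝ) < j.factorial := by positivity
  have e : Real.Gamma (ν + (j + 1 : ℕ) + 1) = (ν + j + 1) * Real.Gamma (ν + j + 1) := by
    rw [← Real.Gamma_add_one hp.ne']
    push_cast
    ring_nf
  simp only [besselCoeff, e, Nat.factorial_succ]
  push_cast
  simp only [norm_div, norm_mul, norm_pow, norm_neg, norm_one, one_pow, Real.norm_eq_abs,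
    abs_of_pos hG, abs_of_pos hp, abs_of_pos hf, abs_of_pos (by positivity : (0 : ℝ) < j + 1)]
  field_simp

/-- The entire function `t ↦ ∑ (-t) ^ j / (j! Γ (ν + j + 1))`. -/
def besselEntire (ν t : ℝ) : ℝ := ∑' j, besselCoeff ν j * t ^ j

theorem contDiff_besselEntire {ν : ℝ} (hν : 0 ≤ ν) : ContDiff ℝ (⊤ : ℕ∞) (besselEntire ν) := by
  -- The ratio of consecutive coefficients is at most `1 / (j + 1)`, so the radius of convergence is
  -- infinite.
  have hrad : (FormalMultilinearSeries.ofScalars ℝ (besselCoeff ν)).radius = ⊤ := by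
    apply FormalMultilinearSeries.ofScalars_radius_eq_top_of_tendsto
    · exact Filter.Eventually.of_forall (besselCoeff_ne_zero hν)
    · simp only [Nat.succ_eq_add_one, norm_besselCoeff_ratio hν]
      refine squeeze_zero (fun j => by positivity) (fun j => ?_)
        (tendsto_one_div_add_atTop_nhds_zero_nat (𝕜 := ℝ))
      gcongr
      have : (0 : ℝ) ≤ j := by positivity
      nlinarith
  have h := FormalMultilinearSeries.hasFPowerSeriesOnBall
    (FormalMultilinearSeries.ofScalars ℝ (besselCoeff ν)) (by rw [hrad]; exact ENNReal.zero_lt_top)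
  have e : (FormalMultilinearSeries.ofScalars ℝ (besselCoeff ν)).sum = besselEntire ν := by
    funext t
    simp [FormalMultilinearSeries.sum, besselEntire, mul_comm]
  rw [e, hrad] at h
  have h2 := h.analyticOnNhd
  rw [Metric.eball_top] at h2
  exact contDiffOn_univ.1 (h2.contDiffOn uniqueDiffOn_univ)

theorem besselJ_eq {ν x : ℝ} (hx : 0 < x) :
    besselJ ν x = (x / 2) ^ ν * besselEntire ν ((x / 2) ^ 2) := by
  have hx2 : 0 < x / 2 := by positivity
  rw [besselJ, besselEntire, ← tsum_mul_left]
  congr 1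
  funext j
  rw [Real.rpow_add hx2, Real.rpow_mul hx2.le, besselCoeff]
  norm_cast
  ring

/-- The smooth factor of the eigenmode. -/
def besselProfile (ν μ : ℝ) (x : EuclideanSpace ℝ (Fin 2)) : ℝ :=
  (μ / 2) ^ ν * besselEntire ν ((μ / 2) ^ 2 * ‖x‖ ^ 2)

theorem contDiff_besselProfile {ν : ℝ} (hν : 0 ≤ ν) (μ : ℝ) :
    ContDiff ℝ (⊤ : ℕ∞) (besselProfile ν μ) :=
  contDiff_const.mul ((contDiff_besselEntire hν).comp (contDiff_const.mul (contDiff_norm_sq ℝ)))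

theorem branchPow_eq (β : ℝ) {x : EuclideanSpace ℝ (Fin 2)} (hx : x ∈ slitDomain) :
    (branchPow β x).re =
      ‖x‖ ^ β * Real.cos (β * (Complex.arg (-toComplex x) + Real.pi)) := by
  rw [branchPow, Complex.exp_re, Real.rpow_def_of_pos (norm_pos_of_mem_slitDomain hx)]
  simp [Complex.log_re, Complex.log_im, toComplex.norm_map, mul_comm]

theorem eigenmode_eqOn {ν μ : ℝ} (hμ : 0 < μ) :
    Set.EqOn (eigenmode ν μ) (powMode ν (fun x => (besselProfile ν μ x : ℂ))) slitDomain := by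
  intro x hx
  have hr := norm_pos_of_mem_slitDomain hx
  -- Strictness excludes the angle `2π`, which `polarAngle` would send to `0`.
  have hφ : Complex.arg (-toComplex x) < Real.pi :=
    lt_of_le_of_ne (Complex.arg_le_pi _) (Complex.mem_slitPlane_iff_arg.1 hx).1
  rw [powMode, Complex.re_mul_ofReal, branchPow_eq ν hx]
  nth_rewrite 1 [eq_polar x]
  rw [eigenmode_polar ν μ _ _ hr (by linarith [Complex.neg_pi_lt_arg (-toComplex x)])
    (by linarith), besselJ_eq (by positivity), besselProfile,
    mul_div_right_comm, Real.mul_rpow (by positivity) hr.le, mul_pow]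
  ring

/-! ### Classical derivatives are weak derivatives -/

theorem tsupport_partialDeriv_subset (i : Fin 2) (ψ : EuclideanSpace ℝ (Fin 2) → ℝ) :
    tsupport (partialDeriv i ψ) ⊆ tsupport ψ := by
  refine closure_minimal (fun x hx => ?_) isClosed_closure
  by_contra h
  have h0 : ψ =ᶠ[nhds x] fun _ => 0 := notMem_tsupport_iff_eventuallyEq.1 h
  apply hx
  rw [partialDeriv, h0.fderiv_eq]
  simp

theorem integral_mul_partialDeriv {Ω : Set (EuclideanSpace ℝ (Fin 2))} (hΩ : IsOpen Ω) (i : Fin 2)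
    {v ψ : EuclideanSpace ℝ (Fin 2) → ℝ} (hv : ContDiffOn ℝ (⊤ : ℕ∞) v Ω)
    (hψ : ContDiff ℝ (⊤ : ℕ∞) ψ) (hc : HasCompactSupport ψ) (hs : tsupport ψ ⊆ Ω) :
    ∫ x in Ω, v x * partialDeriv i ψ x = -∫ x in Ω, partialDeriv i v x * ψ x := by
  -- `f` is controlled only on `Ω`, but the product vanishes near every point outside `tsupport ψ`,
  -- so it is continuous on the whole plane.
  have key : ∀ f g : EuclideanSpace ℝ (Fin 2) → ℝ, ContinuousOn f Ω → Continuous g →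
      tsupport g ⊆ tsupport ψ → MeasureTheory.Integrable (fun x => f x * g x) := by
    intro f g hf hg hgs
    have hcs : HasCompactSupport (fun x => f x * g x) :=
      (hc.mono' (subset_closure.trans hgs)).mul_left
    refine Continuous.integrable_of_hasCompactSupport ?_ hcs
    refine continuous_iff_continuousAt.2 fun x => ?_
    by_cases hx : x ∈ tsupport ψ
    · exact (hf.continuousAt (hΩ.mem_nhds (hs hx))).mul hg.continuousAt
    · have h0 : g =ᶠ[nhds x] 0 := notMem_tsupport_iff_eventuallyEq.1 fun h => hx (hgs h)
      have : (fun x => f x * g x) =ᶠ[nhds x] fun _ => 0 := by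
        filter_upwards [h0] with y hy
        simp [hy]
      exact continuousAt_const.congr this.symm
  have hout : ∀ x, x ∉ Ω → ψ x = 0 ∧ partialDeriv i ψ x = 0 := fun x hx =>
    ⟨image_eq_zero_of_notMem_tsupport fun h => hx (hs h),
      image_eq_zero_of_notMem_tsupport fun h => hx (hs (tsupport_partialDeriv_subset i ψ h))⟩
  rw [MeasureTheory.setIntegral_eq_integral_of_forall_compl_eq_zero
      fun x hx => by rw [(hout x hx).2, mul_zero],
    MeasureTheory.setIntegral_eq_integral_of_forall_compl_eq_zero
      fun x hx => by rw [(hout x hx).1, mul_zero]]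
  exact integral_mul_fderiv_eq_neg_fderiv_mul_of_integrable
    (key _ _ (contDiffOn_partialDeriv hΩ i hv).continuousOn hψ.continuous subset_rfl)
    (key _ _ hv.continuousOn (contDiff_partialDeriv i hψ).continuous (tsupport_partialDeriv_subset i ψ))
    (key _ _ hv.continuousOn hψ.continuous subset_rfl)
    (fun x hx => ((hv.contDiffAt (hΩ.mem_nhds (hs hx))).differentiableAt (by simp)))
    (fun x _ => hψ.differentiable (by simp) x)

theorem tsupport_partialDeriv_iterate_subset (i : Fin 2) (n : ℕ)
    (ψ : EuclideanSpace ℝ (Fin 2) → ℝ) : tsupport ((partialDeriv i)^[n] ψ) ⊆ tsupport ψ := by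
  induction n with
  | zero => exact subset_rfl
  | succ n ih =>
    rw [Function.iterate_succ_apply']
    exact (tsupport_partialDeriv_subset i _).trans ih

theorem integral_mul_partialDeriv_iterate {Ω : Set (EuclideanSpace ℝ (Fin 2))} (hΩ : IsOpen Ω)
    (i : Fin 2) (n : ℕ) {v ψ : EuclideanSpace ℝ (Fin 2) → ℝ} (hv : ContDiffOn ℝ (⊤ : ℕ∞) v Ω)
    (hψ : ContDiff ℝ (⊤ : ℕ∞) ψ) (hc : HasCompactSupport ψ) (hs : tsupport ψ ⊆ Ω) :
    ∫ x in Ω, v x * (partialDeriv i)^[n] ψ x =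
      (-1) ^ n * ∫ x in Ω, (partialDeriv i)^[n] v x * ψ x := by
  induction n generalizing v with
  | zero => simp
  | succ n ih =>
    have hsub := tsupport_partialDeriv_iterate_subset i n ψ
    have h1 := integral_mul_partialDeriv hΩ i hv (contDiff_partialDeriv_iterate i n hψ)
      (hc.mono' (subset_closure.trans hsub)) (hsub.trans hs)
    rw [← Function.iterate_succ_apply' (partialDeriv i) n ψ] at h1
    rw [h1, ih (contDiffOn_partialDeriv hΩ i hv), ← Function.iterate_succ_apply]
    ring

/-- The outermost derivative of `multiDeriv α ψ` is moved first, so `∂₀` reaches `u` before `∂₁`;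
with this order no commutation of derivatives is needed. -/
theorem isWeakDeriv_of_contDiffOn {Ω : Set (EuclideanSpace ℝ (Fin 2))} (hΩ : IsOpen Ω)
    (α : Fin 2 → ℕ) {u : EuclideanSpace ℝ (Fin 2) → ℝ} (hu : ContDiffOn ℝ (⊤ : ℕ∞) u Ω) :
    IsWeakDeriv Ω α u ((partialDeriv 1)^[α 1] ((partialDeriv 0)^[α 0] u)) := by
  have h0 := contDiffOn_partialDeriv_iterate hΩ 0 (α 0) hu
  have h1 := contDiffOn_partialDeriv_iterate hΩ 1 (α 1) h0
  refine ⟨hu.continuousOn.locallyIntegrableOn hΩ.measurableSet,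
    h1.continuousOn.locallyIntegrableOn hΩ.measurableSet, fun ψ hψ hc hs => ?_⟩
  have hsub := tsupport_partialDeriv_iterate_subset 1 (α 1) ψ
  rw [multiDeriv, integral_mul_partialDeriv_iterate hΩ 0 (α 0) hu
    (contDiff_partialDeriv_iterate 1 (α 1) hψ) (hc.mono' (subset_closure.trans hsub))
    (hsub.trans hs), integral_mul_partialDeriv_iterate hΩ 1 (α 1) h0 hψ hc hs, pow_add, mul_assoc]

/-! ### Power weights and the double integral -/

theorem integrableOn_ball_norm_rpow {p : ℝ} (hp : -2 < p) (r : ℝ) :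
    MeasureTheory.IntegrableOn (fun x : EuclideanSpace ℝ (Fin 2) => ‖x‖ ^ p)
      (Metric.ball 0 r) := by
  refine MeasureTheory.integrableOn_ball_of_norm_le_rpow (C := 1) (α := -p) (by simp)
    (by simp; linarith) ?_ ?_
  · filter_upwards with x
    rw [one_mul, neg_neg, Real.norm_of_nonneg (by positivity)]
  · exact (measurable_norm.pow_const p).aestronglyMeasurable

theorem memLp_two_of_le_norm_rpow {Ω : Set (EuclideanSpace ℝ (Fin 2))} (hΩ : MeasurableSet Ω)
    (hb : Ω ⊆ Metric.ball 0 1) {v : EuclideanSpace ℝ (Fin 2) → ℝ} (hv : ContinuousOn v Ω)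
    {C b : ℝ} (hb1 : -1 < b) (h : ∀ x ∈ Ω, |v x| ≤ C * ‖x‖ ^ b) :
    MeasureTheory.MemLp v 2 (MeasureTheory.volume.restrict Ω) := by
  have hm := hv.aestronglyMeasurable (μ := MeasureTheory.volume) hΩ
  rw [MeasureTheory.memLp_two_iff_integrable_sq hm]
  have h1 : MeasureTheory.IntegrableOn (fun x : EuclideanSpace ℝ (Fin 2) => C ^ 2 * ‖x‖ ^ (2 * b)) Ω :=
    ((integrableOn_ball_norm_rpow (by linarith) 1).mono_set hb).const_mul _
  refine h1.mono' (hm.pow 2) ?_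
  filter_upwards [MeasureTheory.ae_restrict_mem hΩ] with x hx
  rw [norm_pow, Real.norm_eq_abs]
  calc |v x| ^ 2 ≤ (C * ‖x‖ ^ b) ^ 2 := by gcongr; exact h x hx
    _ = C ^ 2 * ‖x‖ ^ (2 * b) := by
      rw [mul_pow, ← Real.rpow_natCast (‖x‖ ^ b), ← Real.rpow_mul (norm_nonneg x)]
      congr 2
      push_cast
      ring

theorem lintegral_norm_sub_rpow_le {a : ℝ} {Ω : Set (EuclideanSpace ℝ (Fin 2))}
    (hΩ : MeasurableSet Ω) (hb : Ω ⊆ Metric.ball 0 1) {x : EuclideanSpace ℝ (Fin 2)}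
    (hx : x ∈ Ω) :
    ∫⁻ y in Ω, ENNReal.ofReal (‖x - y‖ ^ (-a)) ≤
      ∫⁻ z in Metric.ball (0 : EuclideanSpace ℝ (Fin 2)) 2, ENNReal.ofReal (‖z‖ ^ (-a)) := by
  rw [← MeasureTheory.lintegral_indicator hΩ,
    ← MeasureTheory.lintegral_indicator Metric.isOpen_ball.measurableSet,
    ← MeasureTheory.lintegral_sub_left_eq_self
      ((Metric.ball (0 : EuclideanSpace ℝ (Fin 2)) 2).indicator _) x]
  refine MeasureTheory.lintegral_mono fun y => ?_
  by_cases hy : y ∈ Ω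
  · have h1 := mem_ball_zero_iff.1 (hb hx)
    have h2 := mem_ball_zero_iff.1 (hb hy)
    have h3 : x - y ∈ Metric.ball (0 : EuclideanSpace ℝ (Fin 2)) 2 := by
      rw [mem_ball_zero_iff]
      linarith [norm_sub_le x y]
    rw [Set.indicator_of_mem hy, Set.indicator_of_mem h3]
  · simp [hy]

/-- By Tonelli and the symmetry of the kernel, each of the two terms is at most `∫ w` times the
integral of `‖z‖^(-a)` over the disc of radius `2`, finite as `a < 2`. -/
theorem slobodeckijSq_lt_top
    {d : EuclideanSpace ℝ (Fin 2) → EuclideanSpace ℝ (Fin 2) → ℝ≥0∞}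
    {Ω : Set (EuclideanSpace ℝ (Fin 2))} (hΩ : MeasurableSet Ω) (hb : Ω ⊆ Metric.ball 0 1)
    {σ a C : ℝ} {v w : EuclideanSpace ℝ (Fin 2) → ℝ} (ha : a < 2) (hC : 0 ≤ C)
    (hwm : Measurable w) (hw0 : ∀ x, 0 ≤ w x) (hw : MeasureTheory.IntegrableOn w Ω)
    (h : ∀ x ∈ Ω, ∀ y ∈ Ω, ‖v x - v y‖ₑ ^ 2 / d x y ^ (2 + 2 * σ) ≤
      ENNReal.ofReal (C * ((w x + w y) * ‖x - y‖ ^ (-a)))) :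
    slobodeckijSq d Ω σ v < ⊤ := by
  set κ : EuclideanSpace ℝ (Fin 2) → ℝ≥0∞ := fun z => ENNReal.ofReal (‖z‖ ^ (-a)) with hκ
  set W : EuclideanSpace ℝ (Fin 2) → ℝ≥0∞ := fun z => ENNReal.ofReal (w z) with hW
  have hκm : Measurable κ := (measurable_norm.pow_const _).ennreal_ofReal
  have hWm : Measurable W := hwm.ennreal_ofReal
  have hmm : Measurable fun p : EuclideanSpace ℝ (Fin 2) × EuclideanSpace ℝ (Fin 2) =>
      W p.2 * κ (p.1 - p.2) :=
    (hWm.comp measurable_snd).mul (hκm.comp (measurable_fst.sub measurable_snd))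
  set K := ∫⁻ z in Metric.ball (0 : EuclideanSpace ℝ (Fin 2)) 2, κ z with hK
  have hKtop : K ≠ ⊤ :=
    ((integrableOn_ball_norm_rpow (p := -a) (by linarith) 2).lintegral_lt_top).ne
  have hWtop : ∫⁻ z in Ω, W z ≠ ⊤ := hw.lintegral_lt_top.ne
  have hsymm : ∀ x y, κ (x - y) = κ (y - x) := fun x y => by
    simp only [hκ, norm_sub_rev]
  have hk : ∀ x, Measurable fun y => κ (x - y) := fun x =>
    hκm.comp (measurable_const.sub measurable_id)
  have hk1 : ∀ x, Measurable fun y => W x * κ (x - y) := fun x => (hk x).const_mul _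
  have hk2 : ∀ x, Measurable fun y => W y * κ (x - y) := fun x => hWm.mul (hk x)
  have h1 : ∫⁻ x in Ω, ∫⁻ y in Ω, W x * κ (x - y) ≤ (∫⁻ x in Ω, W x) * K := by
    rw [← MeasureTheory.lintegral_mul_const _ hWm]
    refine MeasureTheory.setLIntegral_mono' hΩ fun x hx => ?_
    rw [MeasureTheory.lintegral_const_mul _ (hk x)]
    gcongr
    exact lintegral_norm_sub_rpow_le hΩ hb hx
  have h2 : ∫⁻ x in Ω, ∫⁻ y in Ω, W y * κ (x - y) ≤ (∫⁻ x in Ω, W x) * K := by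
    rw [MeasureTheory.lintegral_lintegral_swap hmm.aemeasurable]
    simpa only [hsymm] using h1
  have h3 : slobodeckijSq d Ω σ v ≤
      ∫⁻ x in Ω, ∫⁻ y in Ω, ENNReal.ofReal C * (W x * κ (x - y) + W y * κ (x - y)) := by
    refine MeasureTheory.setLIntegral_mono' hΩ fun x hx =>
      MeasureTheory.setLIntegral_mono' hΩ fun y hy => (h x hx y hy).trans ?_
    rw [ENNReal.ofReal_mul hC, ENNReal.ofReal_mul (add_nonneg (hw0 x) (hw0 y)),
      ENNReal.ofReal_add (hw0 x) (hw0 y), add_mul]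
  have h4 : ∀ x, ∫⁻ y in Ω, ENNReal.ofReal C * (W x * κ (x - y) + W y * κ (x - y)) =
      ENNReal.ofReal C * (∫⁻ y in Ω, W x * κ (x - y)) +
        ENNReal.ofReal C * ∫⁻ y in Ω, W y * κ (x - y) := by
    intro x
    rw [MeasureTheory.lintegral_const_mul _ ((hk1 x).fun_add (hk2 x)),
      MeasureTheory.lintegral_add_left (hk1 x), mul_add]
  have hm1 : Measurable fun x => ∫⁻ y in Ω, W x * κ (x - y) :=
    ((hWm.comp measurable_fst).mul
      (hκm.comp (measurable_fst.sub measurable_snd))).lintegral_prod_right'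
  have hm2 : Measurable fun x => ∫⁻ y in Ω, W y * κ (x - y) := hmm.lintegral_prod_right'
  refine h3.trans_lt ?_
  simp only [h4]
  rw [MeasureTheory.lintegral_add_left (hm1.const_mul _),
    MeasureTheory.lintegral_const_mul _ hm1, MeasureTheory.lintegral_const_mul _ hm2]
  have hfin : (∫⁻ x in Ω, W x) * K < ⊤ := ENNReal.mul_lt_top hWtop.lt_top hKtop.lt_top
  exact ENNReal.add_lt_top.2 ⟨ENNReal.mul_lt_top ENNReal.ofReal_lt_top (h1.trans_lt hfin),
    ENNReal.mul_lt_top ENNReal.ofReal_lt_top (h2.trans_lt hfin)⟩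

/-! ### Pointwise bounds for the difference quotient -/

/-- At infinite distance the quotient is `0`, so only finite distances have to be estimated. -/
theorem enorm_sq_div_rpow_le {δ : ℝ≥0∞} {t s B : ℝ} (hs : 0 < s) (hδ : 0 < δ)
    (h : δ ≠ ⊤ → t ^ 2 ≤ B * δ.toReal ^ s) : ‖t‖ₑ ^ 2 / δ ^ s ≤ ENNReal.ofReal B := by
  by_cases ht : δ = ⊤
  · simp [ht, ENNReal.top_rpow_of_pos hs]
  have hpos : 0 < δ.toReal := ENNReal.toReal_pos hδ.ne' ht
  have h1 := h ht
  rw [ENNReal.div_le_iff (by simp [hδ.ne', ht]) (by simp [hδ.ne', ht])]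
  rw [← ENNReal.ofReal_toReal ht, ENNReal.ofReal_rpow_of_pos hpos,
    ← ENNReal.ofReal_mul' (by positivity), Real.enorm_eq_ofReal_abs,
    ← ENNReal.ofReal_pow (abs_nonneg _), sq_abs]
  exact ENNReal.ofReal_le_ofReal h1

/-- The pointwise bound where the distance `δ` of two points dominates weights `A`, `A'` at the two
points. -/
theorem sq_le_of_crude_bound {V C b q a δ ρ r r' A A' : ℝ} (hq : 0 ≤ q) (ha : 0 ≤ a)
    (hρ : 0 < ρ) (hρδ : ρ ≤ δ) (hr : 0 < r) (hr' : 0 < r') (hA : 0 < A) (hA' : 0 < A')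
    (hAδ : A ≤ 3 * δ) (hAδ' : A' ≤ 3 * δ) (hV : |V| ≤ C * r ^ b + C * r' ^ b) :
    V ^ 2 ≤ 2 * C ^ 2 * 3 ^ q * ((r ^ (2 * b) * A ^ (-q) + r' ^ (2 * b) * A' ^ (-q)) * ρ ^ (-a)) *
      δ ^ (a + q) := by
  have hδ : 0 < δ := hρ.trans_le hρδ
  have sq : ∀ t : ℝ, 0 < t → (t ^ b) ^ 2 = t ^ (2 * b) := fun t ht => by
    rw [← Real.rpow_natCast, ← Real.rpow_mul ht.le, mul_comm]
    norm_cast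
  have h1 : V ^ 2 ≤ 2 * C ^ 2 * (r ^ (2 * b) + r' ^ (2 * b)) := by
    rw [← sq_abs, ← sq r hr, ← sq r' hr']
    have : |V| ^ 2 ≤ (C * r ^ b + C * r' ^ b) ^ 2 := by gcongr
    nlinarith [sq_nonneg (C * r ^ b - C * r' ^ b)]
  -- The factors `(δ/ρ)^a` and `(3δ/B)^q` are at least `1`; inserting them creates the power
  -- `δ^(a+q)` at the cost of the weights.
  have h2 : 1 ≤ ρ ^ (-a) * δ ^ a := by
    rw [Real.rpow_neg hρ.le, inv_mul_eq_div, one_le_div (by positivity)]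
    exact Real.rpow_le_rpow hρ.le hρδ ha
  have h3 : ∀ B : ℝ, 0 < B → B ≤ 3 * δ → 1 ≤ B ^ (-q) * (3 ^ q * δ ^ q) := by
    intro B hB hBδ
    rw [Real.rpow_neg hB.le, inv_mul_eq_div, one_le_div (by positivity),
      ← Real.mul_rpow (by norm_num) hδ.le]
    exact Real.rpow_le_rpow hB.le hBδ hq
  have h4 : ∀ s B : ℝ, 0 < s → 0 < B → B ≤ 3 * δ →
      s ^ (2 * b) ≤ s ^ (2 * b) * ((B ^ (-q) * (3 ^ q * δ ^ q)) * (ρ ^ (-a) * δ ^ a)) := by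
    intro s B hs hB hBδ
    exact le_mul_of_one_le_right (by positivity) (one_le_mul_of_one_le_of_one_le (h3 B hB hBδ) h2)
  calc V ^ 2 ≤ 2 * C ^ 2 * (r ^ (2 * b) + r' ^ (2 * b)) := h1
    _ ≤ 2 * C ^ 2 * (r ^ (2 * b) * ((A ^ (-q) * (3 ^ q * δ ^ q)) * (ρ ^ (-a) * δ ^ a)) +
        r' ^ (2 * b) * ((A' ^ (-q) * (3 ^ q * δ ^ q)) * (ρ ^ (-a) * δ ^ a))) := by
      gcongr
      · exact h4 r A hr hA hAδ
      · exact h4 r' A' hr' hA' hAδ'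
    _ = _ := by
      rw [Real.rpow_add hδ]
      ring

/-- The pointwise bound where the distance `δ` of two points is small compared to the distance `r`
from the origin. -/
theorem sq_le_of_gradient_bound {V L b q a δ ρ r : ℝ} (ha : 0 ≤ a) (hq : q ≤ 2)
    (hρ : 0 < ρ) (hρδ : ρ ≤ δ) (hr : 0 < r) (hδr : δ ≤ r)
    (hV : |V| ≤ L * r ^ (b - 1) * δ) :
    V ^ 2 ≤ L ^ 2 * (r ^ (2 * b - q) * ρ ^ (-a)) * δ ^ (a + q) := by
  have hδ : 0 < δ := hρ.trans_le hρδ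
  have h2 : 1 ≤ ρ ^ (-a) * δ ^ a := by
    rw [Real.rpow_neg hρ.le, inv_mul_eq_div, one_le_div (by positivity)]
    exact Real.rpow_le_rpow hρ.le hρδ ha
  -- Of `δ²` only `δ^q` is kept. The rest becomes `r^(2-q)` and turns `r^(2b-2)` into `r^(2b-q)`,
  -- the weight of the crude bound with `A = r`.
  have h3 : δ ^ (2 - q) ≤ r ^ (2 - q) := Real.rpow_le_rpow hδ.le hδr (by linarith)
  have e1 : δ ^ 2 = δ ^ (2 - q) * δ ^ q := by
    rw [← Real.rpow_add hδ, sub_add_cancel, Real.rpow_two]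
  have e2 : (r ^ (b - 1)) ^ 2 * r ^ (2 - q) = r ^ (2 * b - q) := by
    rw [← Real.rpow_natCast, ← Real.rpow_mul hr.le, ← Real.rpow_add hr]
    congr 1
    push_cast
    ring
  calc V ^ 2 = |V| ^ 2 := (sq_abs V).symm
    _ ≤ (L * r ^ (b - 1) * δ) ^ 2 := by gcongr
    _ = L ^ 2 * (r ^ (b - 1)) ^ 2 * (δ ^ (2 - q) * δ ^ q) := by rw [← e1]; ring
    _ ≤ L ^ 2 * (r ^ (b - 1)) ^ 2 * (r ^ (2 - q) * δ ^ q) * (ρ ^ (-a) * δ ^ a) := by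
      refine le_trans ?_ (le_mul_of_one_le_right (by positivity) h2)
      gcongr
    _ = L ^ 2 * (((r ^ (b - 1)) ^ 2 * r ^ (2 - q)) * ρ ^ (-a)) * δ ^ (a + q) := by
      rw [Real.rpow_add hδ]
      ring
    _ = _ := by rw [e2]

/-! ### The inner distance -/

/-- The path is cut into finitely many pieces, each inside a ball contained in `U`, where convexity
gives the mean value inequality; the chords sum to at most the variation. -/
theorem edist_le_mul_eVariationOn {U : Set (EuclideanSpace ℝ (Fin 2))} (hU : IsOpen U)
    {v : EuclideanSpace ℝ (Fin 2) → ℝ} (hv : ∀ z ∈ U, DifferentiableAt ℝ v z) {L : NNReal}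
    (hL : ∀ z ∈ U, ‖fderiv ℝ v z‖ ≤ L) {x y : EuclideanSpace ℝ (Fin 2)} (γ : Path x y)
    (hγ : ∀ t, γ t ∈ U) : edist (v x) (v y) ≤ L * eVariationOn γ Set.univ := by
  let ι := {p : EuclideanSpace ℝ (Fin 2) × ℝ // Metric.ball p.1 p.2 ⊆ U}
  obtain ⟨t, ht0, htm, ⟨n, hn⟩, ht⟩ := exists_monotone_Icc_subset_open_cover_unitInterval
    (c := fun p : ι => γ ⁻¹' Metric.ball p.1.1 p.1.2)
    (fun p => Metric.isOpen_ball.preimage γ.continuous) (fun s _ => by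
      obtain ⟨ε, hε, hsub⟩ := Metric.isOpen_iff.1 hU (γ s) (hγ s)
      exact Set.mem_iUnion.2 ⟨⟨(γ s, ε), hsub⟩, Metric.mem_ball_self hε⟩)
  have hstep : ∀ i, edist (v (γ (t i))) (v (γ (t (i + 1)))) ≤
      L * edist (γ (t (i + 1))) (γ (t i)) := by
    intro i
    obtain ⟨p, hp⟩ := ht i
    have hlip : LipschitzOnWith L v (Metric.ball p.1.1 p.1.2) :=
      (convex_ball _ _).lipschitzOnWith_of_nnnorm_fderiv_le (𝕜 := ℝ)
        (fun z hz => hv z (p.2 hz)) (fun z hz => hL z (p.2 hz))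
    rw [edist_comm (γ (t (i + 1)))]
    exact hlip (hp ⟨le_rfl, htm (Nat.le_succ i)⟩) (hp ⟨htm (Nat.le_succ i), le_rfl⟩)
  calc edist (v x) (v y) = edist (v (γ (t 0))) (v (γ (t n))) := by
        rw [ht0, hn n le_rfl, γ.source, γ.target]
    _ ≤ ∑ i ∈ Finset.range n, edist (v (γ (t i))) (v (γ (t (i + 1)))) :=
      edist_le_range_sum_edist (fun i => v (γ (t i))) n
    _ ≤ ∑ i ∈ Finset.range n, L * edist (γ (t (i + 1))) (γ (t i)) :=
      Finset.sum_le_sum fun i _ => hstep i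
    _ = L * ∑ i ∈ Finset.range n, edist (γ (t (i + 1))) (γ (t i)) := by rw [Finset.mul_sum]
    _ ≤ L * eVariationOn γ Set.univ := by
      gcongr
      exact eVariationOn.sum_le htm fun _ => Set.mem_univ _

theorem edist_le_innerEDist (Ω : Set (EuclideanSpace ℝ (Fin 2)))
    (x y : EuclideanSpace ℝ (Fin 2)) : edist x y ≤ innerEDist Ω x y := by
  refine le_iInf₂ fun γ _ => ?_
  have h := eVariationOn.edist_le γ (Set.mem_univ 0) (Set.mem_univ 1)
  rwa [γ.source, γ.target] at h

/-- A path from `x` shorter than `‖x‖ / 2` stays outside the disc of radius `‖x‖ / 2`, where the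
gradient is at most `C (‖x‖ / 2)^(b-1)` because `b ≤ 1`. -/
theorem abs_sub_le_of_innerEDist_lt {Ω : Set (EuclideanSpace ℝ (Fin 2))} (hΩ : IsOpen Ω)
    {v : EuclideanSpace ℝ (Fin 2) → ℝ} (hv : ∀ z ∈ Ω, DifferentiableAt ℝ v z) {C b : ℝ}
    (hb : b ≤ 1) (hC : 0 ≤ C) (h : ∀ z ∈ Ω, ‖fderiv ℝ v z‖ ≤ C * ‖z‖ ^ (b - 1))
    {x y : EuclideanSpace ℝ (Fin 2)} (hx : 0 < ‖x‖)
    (hd : innerEDist Ω x y < ENNReal.ofReal (‖x‖ / 2)) :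
    |v x - v y| ≤ C * (1 / 2) ^ (b - 1) * ‖x‖ ^ (b - 1) * (innerEDist Ω x y).toReal := by
  have htop : innerEDist Ω x y ≠ ⊤ := hd.ne_top
  set L : NNReal := ⟨C * (1 / 2) ^ (b - 1) * ‖x‖ ^ (b - 1), by positivity⟩ with hLdef
  have key : edist (v x) (v y) ≤ L * innerEDist Ω x y := by
    by_contra hcon
    rw [not_le] at hcon
    -- The infimum of lengths need not be attained; a slightly larger `ℓ` still violates the
    -- inequality and bounds the length of an actual path.
    obtain ⟨ℓ, h1, h2⟩ : ∃ ℓ, innerEDist Ω x y < ℓ ∧ ℓ < ENNReal.ofReal (‖x‖ / 2) ∧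
        L * ℓ < edist (v x) (v y) := by
      have hcont : Filter.Tendsto (fun ℓ : ℝ≥0∞ => L * ℓ)
          (nhdsWithin (innerEDist Ω x y) (Set.Ioi (innerEDist Ω x y)))
          (nhds (L * innerEDist Ω x y)) :=
        ((ENNReal.continuous_const_mul ENNReal.coe_ne_top).tendsto _).mono_left nhdsWithin_le_nhds
      have hne : (nhdsWithin (innerEDist Ω x y) (Set.Ioi (innerEDist Ω x y))).NeBot :=
        nhdsGT_neBot_of_exists_gt ⟨_, hd⟩
      obtain ⟨ℓ, ha, hb, hc⟩ := ((hcont.eventually_lt_const hcon).and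
        (Ioo_mem_nhdsGT hd)).exists
      exact ⟨ℓ, hb, hc, ha⟩
    obtain ⟨γ, hγΩ, hγ⟩ : ∃ (γ : Path x y) (_ : ∀ t, γ t ∈ Ω), eVariationOn γ Set.univ < ℓ := by
      simpa only [innerEDist, iInf_lt_iff] using h1
    have hfar : ∀ t, γ t ∈ Ω ∩ {z | ‖x‖ / 2 < ‖z‖} := by
      intro t
      refine ⟨hγΩ t, ?_⟩
      have h3 := eVariationOn.edist_le γ (Set.mem_univ 0) (Set.mem_univ t)
      rw [γ.source] at h3
      have h4 := h3.trans_lt (hγ.trans h2.1)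
      rw [edist_dist, ENNReal.ofReal_lt_ofReal_iff (by positivity), dist_eq_norm] at h4
      have h5 := norm_sub_norm_le x (γ t)
      change ‖x‖ / 2 < ‖γ t‖
      linarith
    have hU : IsOpen (Ω ∩ {z | ‖x‖ / 2 < ‖z‖}) :=
      hΩ.inter (isOpen_lt continuous_const continuous_norm)
    have h6 := edist_le_mul_eVariationOn hU (fun z hz => hv z hz.1) (L := L) (fun z hz => by
      refine (h z hz.1).trans ?_
      change _ ≤ C * (1 / 2) ^ (b - 1) * ‖x‖ ^ (b - 1)
      rw [mul_assoc, ← Real.mul_rpow (by norm_num) hx.le]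
      have h7 : ‖x‖ / 2 < ‖z‖ := hz.2
      exact mul_le_mul_of_nonneg_left (Real.rpow_le_rpow_of_nonpos
        (by linarith : 0 < 1 / 2 * ‖x‖) (by linarith) (by linarith)) hC) γ hfar
    have h7 : (L : ℝ≥0∞) * eVariationOn γ Set.univ ≤ L * ℓ := by gcongr
    exact absurd h2.2 (not_lt.2 (h6.trans h7))
  have h8 := ENNReal.toReal_mono (ENNReal.mul_ne_top ENNReal.coe_ne_top htop) key
  rw [ENNReal.toReal_mul, edist_dist, ENNReal.toReal_ofReal dist_nonneg, Real.dist_eq] at h8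
  exact h8

/-- The pointwise bound for the inner distance. -/
theorem enorm_sq_div_innerEDist_le {Ω : Set (EuclideanSpace ℝ (Fin 2))} (hΩ : IsOpen Ω)
    (hΩ0 : ∀ x ∈ Ω, 0 < ‖x‖)
    {v : EuclideanSpace ℝ (Fin 2) → ℝ} (hv : ∀ z ∈ Ω, DifferentiableAt ℝ v z) {C b a q σ : ℝ}
    (hb : b ≤ 1) (hC : 0 ≤ C) (h0 : ∀ z ∈ Ω, |v z| ≤ C * ‖z‖ ^ b)
    (h1 : ∀ z ∈ Ω, ‖fderiv ℝ v z‖ ≤ C * ‖z‖ ^ (b - 1))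
    (ha : 0 ≤ a) (hq : 0 ≤ q) (hq2 : q ≤ 2) (haq : a + q = 2 + 2 * σ) (hσ : 0 < σ)
    {x y : EuclideanSpace ℝ (Fin 2)} (hx : x ∈ Ω) (hy : y ∈ Ω) (hxy : x ≠ y) :
    ‖v x - v y‖ₑ ^ 2 / innerEDist Ω x y ^ (2 + 2 * σ) ≤
      ENNReal.ofReal ((2 * C ^ 2 * 3 ^ q + (C * (1 / 2) ^ (b - 1)) ^ 2) *
        ((‖x‖ ^ (2 * b - q) + ‖y‖ ^ (2 * b - q)) * ‖x - y‖ ^ (-a))) := by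
  have hρ : 0 < ‖x - y‖ := norm_pos_iff.2 (sub_ne_zero.2 hxy)
  have hrx := hΩ0 x hx
  have hry := hΩ0 y hy
  have hle := edist_le_innerEDist Ω x y
  refine enorm_sq_div_rpow_le (by positivity) ((edist_pos.2 hxy).trans_le hle) fun htop => ?_
  set δ := (innerEDist Ω x y).toReal with hδ
  have hρδ : ‖x - y‖ ≤ δ := by
    have := ENNReal.toReal_mono htop hle
    rwa [edist_dist, ENNReal.toReal_ofReal dist_nonneg, dist_eq_norm] at this
  have hδ0 : 0 < δ := hρ.trans_le hρδ
  rw [← haq]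
  -- In the second case `‖x‖ ≤ 2δ` and `‖y‖ ≤ ‖x‖ + δ ≤ 3δ`, whence the `3` in
  -- `sq_le_of_crude_bound`.
  by_cases hd : δ < ‖x‖ / 2
  · have h2 := abs_sub_le_of_innerEDist_lt hΩ hv hb hC h1 hrx
      ((ENNReal.lt_ofReal_iff_toReal_lt htop).2 hd)
    refine (sq_le_of_gradient_bound ha hq2 hρ hρδ hrx (by linarith) h2).trans ?_
    gcongr
    · exact le_add_of_nonneg_left (by positivity)
    · exact le_add_of_nonneg_right (by positivity)
  · rw [not_lt] at hd
    have h3 : |v x - v y| ≤ C * ‖x‖ ^ b + C * ‖y‖ ^ b :=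
      (abs_sub _ _).trans (add_le_add (h0 x hx) (h0 y hy))
    have h4 : ‖y‖ ≤ 3 * δ := by
      have := norm_sub_norm_le y x
      rw [norm_sub_rev] at this
      linarith
    have e : ∀ r : ℝ, 0 < r → r ^ (2 * b) * r ^ (-q) = r ^ (2 * b - q) := fun r hr => by
      rw [← Real.rpow_add hr, sub_eq_add_neg]
    have h5 := sq_le_of_crude_bound hq ha hρ hρδ hrx hry hrx hry (by linarith) h4 h3
    rw [e _ hrx, e _ hry] at h5
    refine h5.trans ?_
    gcongr
    exact le_add_of_nonneg_right (by positivity)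

theorem innerEDist_le_of_lipschitz {Ω : Set (EuclideanSpace ℝ (Fin 2))}
    {γ : ℝ → EuclideanSpace ℝ (Fin 2)} {K : ℝ} (hK : 0 ≤ K)
    (hγ : ∀ s ∈ Set.Icc (0 : ℝ) 1, ∀ t ∈ Set.Icc (0 : ℝ) 1, ‖γ s - γ t‖ ≤ K * |s - t|)
    (hΩ : ∀ t ∈ Set.Icc (0 : ℝ) 1, γ t ∈ Ω) :
    innerEDist Ω (γ 0) (γ 1) ≤ ENNReal.ofReal K := by
  have hlip : LipschitzOnWith K.toNNReal γ (Set.Icc 0 1) :=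
    LipschitzOnWith.of_dist_le_mul fun s hs t ht => by
      rw [Real.coe_toNNReal K hK, dist_eq_norm, Real.dist_eq]
      exact hγ s hs t ht
  let p : Path (γ 0) (γ 1) :=
    { toFun := fun t : unitInterval => γ t
      continuous_toFun := hlip.continuousOn.comp_continuous continuous_subtype_val
        fun t : unitInterval => t.2
      source' := by simp
      target' := by simp }
  have hp : ∀ t, p t ∈ Ω := fun t => hΩ _ t.2
  refine (iInf₂_le p hp).trans ?_
  have h1 : eVariationOn (γ ∘ ((↑) : unitInterval → ℝ)) Set.univ ≤
      K.toNNReal * eVariationOn ((↑) : unitInterval → ℝ) Set.univ :=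
    hlip.comp_eVariationOn_le fun t _ => t.2
  have h2 : eVariationOn ((↑) : unitInterval → ℝ) Set.univ ≤ 1 := by
    have h3 := MonotoneOn.eVariationOn_eq (f := ((↑) : unitInterval → ℝ)) (s := Set.univ)
      (a := 0) (b := 1) (fun _ _ _ _ h => h) (Set.mem_univ _) (Set.mem_univ _)
    have h4 : Set.univ ∩ Set.Icc (0 : unitInterval) 1 = Set.univ := by
      ext t
      simp [unitInterval.le_one']
    rw [h4] at h3
    simp [h3]
  calc eVariationOn p Set.univ ≤ K.toNNReal * 1 := h1.trans (by gcongr)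
    _ = ENNReal.ofReal K := mul_one _

theorem innerEDist_le_edist_of_segment {Ω : Set (EuclideanSpace ℝ (Fin 2))}
    {x y : EuclideanSpace ℝ (Fin 2)} (h : segment ℝ x y ⊆ Ω) : innerEDist Ω x y ≤ edist x y := by
  have h1 := innerEDist_le_of_lipschitz (Ω := Ω) (γ := AffineMap.lineMap x y) (K := dist x y)
    dist_nonneg (fun s _ t _ => by
      rw [← dist_eq_norm, dist_lineMap_lineMap, Real.dist_eq, mul_comm])
    (fun t ht => h (by rw [segment_eq_image_lineMap]; exact ⟨t, ht, rfl⟩))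
  rwa [AffineMap.lineMap_apply_zero, AffineMap.lineMap_apply_one, ← edist_dist] at h1

theorem norm_polar_sub_polar_sq (r r' φ φ' : ℝ) :
    ‖(!₂[r * Real.cos φ, r * Real.sin φ] - !₂[r' * Real.cos φ', r' * Real.sin φ'] :
      EuclideanSpace ℝ (Fin 2))‖ ^ 2 =
      (r - r') ^ 2 + 4 * (r * r') * Real.sin ((φ - φ') / 2) ^ 2 := by
  have h1 : Real.cos (φ - φ') = 1 - 2 * Real.sin ((φ - φ') / 2) ^ 2 := by
    have := Real.cos_sq' ((φ - φ') / 2)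
    have h2 := Real.cos_two_mul ((φ - φ') / 2)
    rw [mul_div_cancel₀ _ two_ne_zero] at h2
    linarith
  rw [EuclideanSpace.norm_sq_eq]
  simp only [Fin.sum_univ_two, Real.norm_eq_abs, sq_abs]
  simp
  rw [Real.cos_sub] at h1
  linear_combination r ^ 2 * Real.sin_sq_add_cos_sq φ + r' ^ 2 * Real.sin_sq_add_cos_sq φ' -
    2 * r * r' * h1

theorem norm_polar_sub_polar_le {r r' φ φ' R : ℝ} (hr : 0 ≤ r) (hr' : 0 ≤ r') (hR : r ≤ R)
    (hR' : r' ≤ R) :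
    ‖(!₂[r * Real.cos φ, r * Real.sin φ] - !₂[r' * Real.cos φ', r' * Real.sin φ'] :
      EuclideanSpace ℝ (Fin 2))‖ ≤ |r - r'| + R * |φ - φ'| := by
  have hR0 : 0 ≤ R := hr.trans hR
  refine abs_le_of_sq_le_sq' ?_ (by positivity) |>.2
  rw [norm_polar_sub_polar_sq]
  have h1 : Real.sin ((φ - φ') / 2) ^ 2 ≤ ((φ - φ') / 2) ^ 2 := by
    exact sq_le_sq.2 Real.abs_sin_le_abs
  have h2 : r * r' ≤ R * R := by gcongr
  have h3 : 4 * (r * r') * Real.sin ((φ - φ') / 2) ^ 2 ≤ 4 * (R * R) * ((φ - φ') / 2) ^ 2 := by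
    gcongr
  have h4 : 0 ≤ |r - r'| * (R * |φ - φ'|) := by positivity
  nlinarith [sq_abs (r - r'), sq_abs (φ - φ')]

theorem mul_sin_le_sin_mul {m t : ℝ} (hm : 0 < m) (hm' : m ≤ Real.pi) (ht : 0 ≤ t) (htm : t ≤ m) :
    t / m * Real.sin m ≤ Real.sin t := by
  have h := strictConcaveOn_sin_Icc.concaveOn.2 (Set.mem_Icc.2 ⟨hm.le, hm'⟩)
    (Set.left_mem_Icc.2 Real.pi_pos.le) (by positivity : 0 ≤ t / m)
    (by rw [sub_nonneg, div_le_one hm]; exact htm : 0 ≤ 1 - t / m) (by ring)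
  simpa [div_mul_cancel₀ _ hm.ne'] using h

/-- On a sector of angle less than `2π` the inner distance and the distance are equivalent. -/
theorem exists_innerEDist_le_mul_edist {ω : ℝ} (hω : 0 < ω) (hω' : ω < 2 * Real.pi) :
    ∃ K : ℝ, 0 < K ∧ ∀ x ∈ sector ω, ∀ y ∈ sector ω,
      innerEDist (sector ω) x y ≤ ENNReal.ofReal K * edist x y := by
  -- By concavity of the sine, `c |θ| ≤ |sin(θ/2)|` for `|θ| ≤ ω`. Positivity of `c` requires `ω <
  -- 2π`.
  set c : ℝ := Real.sin (ω / 2) / ω with hc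
  have hc0 : 0 < c :=
    div_pos (Real.sin_pos_of_pos_of_lt_pi (by positivity) (by linarith)) hω
  set K : ℝ := 1 + Real.sqrt (1 / (2 * c ^ 2) + 2 * ω ^ 2) with hK
  have hK0 : 0 < K := by positivity
  refine ⟨K, hK0, ?_⟩
  rintro _ ⟨r, φ, hr, hr1, hφ, hφ', rfl⟩ _ ⟨r', ψ, hr', hr1', hψ, hψ', rfl⟩
  set ρ : ℝ := ‖(!₂[r * Real.cos φ, r * Real.sin φ] - !₂[r' * Real.cos ψ, r' * Real.sin ψ] :
      EuclideanSpace ℝ (Fin 2))‖ with hρ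
  have hρ0 : 0 ≤ ρ := norm_nonneg _
  have hρ2 := norm_polar_sub_polar_sq r r' φ ψ
  rw [← hρ] at hρ2
  set R : ℝ := max r r' with hR
  have hR0 : 0 < R := lt_max_of_lt_left hr
  have hθ : |φ - ψ| ≤ ω := abs_le.2 ⟨by linarith, by linarith⟩
  have hsin : c ^ 2 * (φ - ψ) ^ 2 ≤ Real.sin ((φ - ψ) / 2) ^ 2 := by
    have h1 := mul_sin_le_sin_mul (m := ω / 2) (t := |φ - ψ| / 2) (by positivity) (by linarith)
      (by positivity) (by linarith)
    have h2 : Real.sin (|φ - ψ| / 2) ^ 2 = Real.sin ((φ - ψ) / 2) ^ 2 := by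
      rcases abs_choice (φ - ψ) with h | h <;> rw [h]
      rw [neg_div, Real.sin_neg, neg_sq]
    have h3 : |φ - ψ| / 2 / (ω / 2) * Real.sin (ω / 2) = c * |φ - ψ| := by
      rw [hc]
      field_simp
    rw [h3] at h1
    rw [← h2, ← sq_abs (φ - ψ), ← mul_pow]
    gcongr
  have hrad : |r - r'| ≤ ρ := by
    refine abs_le_of_sq_le_sq ?_ hρ0
    rw [hρ2]
    exact le_add_of_nonneg_right (by positivity)
  have hang : R * |φ - ψ| ≤ Real.sqrt (1 / (2 * c ^ 2) + 2 * ω ^ 2) * ρ := by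
    refine abs_le_of_sq_le_sq' ?_ (by positivity) |>.2
    rw [mul_pow, mul_pow, Real.sq_sqrt (by positivity), sq_abs]
    -- The product `r r'` is what the chord formula controls; the excess of `R²` over it is charged
    -- to the radial difference.
    have h1 : R ^ 2 ≤ 2 * (r * r') + 2 * (r - r') ^ 2 := by
      rcases max_cases r r' with ⟨h, _⟩ | ⟨h, _⟩ <;> rw [hR, h] <;> nlinarith
    have h2 : r * r' * (φ - ψ) ^ 2 ≤ ρ ^ 2 / (4 * c ^ 2) := by
      rw [le_div_iff₀ (by positivity), hρ2]
      nlinarith [mul_le_mul_of_nonneg_left hsin (by positivity : 0 ≤ 4 * (r * r')),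
        sq_nonneg (r - r')]
    have h3 : (r - r') ^ 2 * (φ - ψ) ^ 2 ≤ ρ ^ 2 * ω ^ 2 := by
      rw [← sq_abs (r - r'), ← sq_abs (φ - ψ)]
      gcongr
    calc R ^ 2 * (φ - ψ) ^ 2 ≤ (2 * (r * r') + 2 * (r - r') ^ 2) * (φ - ψ) ^ 2 := by gcongr
      _ = 2 * (r * r' * (φ - ψ) ^ 2) + 2 * ((r - r') ^ 2 * (φ - ψ) ^ 2) := by ring
      _ ≤ 2 * (ρ ^ 2 / (4 * c ^ 2)) + 2 * (ρ ^ 2 * ω ^ 2) := by gcongr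
      _ = _ := by
        field_simp
        ring
  have hconv : ∀ {a b l u t : ℝ}, t ∈ Set.Icc (0 : ℝ) 1 → l < a → l < b → a < u → b < u →
      l < a + t * (b - a) ∧ a + t * (b - a) < u := by
    intro a b l u t ht h1 h2 h3 h4
    exact (convex_Ioo l u).add_smul_sub_mem ⟨h1, h3⟩ ⟨h2, h4⟩ ht
  -- The comparison path interpolates the polar coordinates linearly, so it stays in the sector.
  have hpath := innerEDist_le_of_lipschitz (Ω := sector ω)
    (γ := fun t => !₂[(r + t * (r' - r)) * Real.cos (φ + t * (ψ - φ)),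
      (r + t * (r' - r)) * Real.sin (φ + t * (ψ - φ))]) (K := |r - r'| + R * |φ - ψ|)
    (by positivity) (fun s hs t ht => by
      have hle : ∀ t ∈ Set.Icc (0 : ℝ) 1, r + t * (r' - r) ≤ R := fun t ht => by
        have h1 := le_max_left r r'
        have h2 := le_max_right r r'
        rw [← hR] at h1 h2
        nlinarith [ht.1, ht.2]
      refine (norm_polar_sub_polar_le (hconv hs hr hr' hr1 hr1').1.le
        (hconv ht hr hr' hr1 hr1').1.le (hle s hs) (hle t ht)).trans (le_of_eq ?_)
      rw [show r + s * (r' - r) - (r + t * (r' - r)) = (r' - r) * (s - t) by ring,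
        show φ + s * (ψ - φ) - (φ + t * (ψ - φ)) = (ψ - φ) * (s - t) by ring, abs_mul, abs_mul,
        abs_sub_comm r', abs_sub_comm ψ]
      ring)
    (fun t ht => ⟨_, _, (hconv ht hr hr' hr1 hr1').1, (hconv ht hr hr' hr1 hr1').2,
      (hconv ht hφ hψ hφ' hψ').1, (hconv ht hφ hψ hφ' hψ').2, rfl⟩)
  simp only [zero_mul, add_zero, one_mul, add_sub_cancel] at hpath
  refine hpath.trans ?_
  rw [edist_dist, dist_eq_norm, ← ENNReal.ofReal_mul hK0.le]
  apply ENNReal.ofReal_le_ofReal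
  rw [← hρ, hK, add_mul, one_mul]
  exact add_le_add hrad hang

theorem slobodeckijSq_lt_top_of_le_mul
    {d d' : EuclideanSpace ℝ (Fin 2) → EuclideanSpace ℝ (Fin 2) → ℝ≥0∞}
    {Ω : Set (EuclideanSpace ℝ (Fin 2))} (hΩ : MeasurableSet Ω) {σ K : ℝ} (hσ : 0 ≤ σ) (hK : 0 < K)
    {v : EuclideanSpace ℝ (Fin 2) → ℝ}
    (h : ∀ x ∈ Ω, ∀ y ∈ Ω, d x y ≤ ENNReal.ofReal K * d' x y) (hd : slobodeckijSq d Ω σ v < ⊤) :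
    slobodeckijSq d' Ω σ v < ⊤ := by
  set c : ℝ≥0∞ := ENNReal.ofReal K ^ (2 + 2 * σ) with hc
  have hK0 : ENNReal.ofReal K ≠ 0 := by simpa using hK
  have hc0 : c ≠ 0 := by
    rw [hc, Ne, ENNReal.rpow_eq_zero_iff]
    simp [hK0]
  have hct : c ≠ ⊤ := ENNReal.rpow_ne_top_of_nonneg (by positivity) ENNReal.ofReal_ne_top
  have hpt : ∀ x ∈ Ω, ∀ y ∈ Ω, ‖v x - v y‖ₑ ^ 2 / d' x y ^ (2 + 2 * σ) ≤
      c * (‖v x - v y‖ₑ ^ 2 / d x y ^ (2 + 2 * σ)) := by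
    intro x hx y hy
    have h1 : d x y ^ (2 + 2 * σ) ≤ c * d' x y ^ (2 + 2 * σ) := by
      rw [hc, ← ENNReal.mul_rpow_of_nonneg _ _ (by positivity)]
      exact ENNReal.rpow_le_rpow (h x hx y hy) (by positivity)
    have h2 := ENNReal.inv_le_inv.2 h1
    rw [ENNReal.mul_inv (Or.inl hc0) (Or.inl hct)] at h2
    have h3 : (d' x y ^ (2 + 2 * σ))⁻¹ ≤ c * (d x y ^ (2 + 2 * σ))⁻¹ := by
      calc (d' x y ^ (2 + 2 * σ))⁻¹ = c * (c⁻¹ * (d' x y ^ (2 + 2 * σ))⁻¹) := by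
            rw [← mul_assoc, ENNReal.mul_inv_cancel hc0 hct, one_mul]
        _ ≤ _ := by gcongr
    rw [div_eq_mul_inv, div_eq_mul_inv, mul_left_comm]
    gcongr
  have h4 : slobodeckijSq d' Ω σ v ≤ c * slobodeckijSq d Ω σ v := by
    rw [slobodeckijSq, slobodeckijSq, ← MeasureTheory.lintegral_const_mul' _ _ hct]
    refine MeasureTheory.setLIntegral_mono' hΩ fun x hx => ?_
    rw [← MeasureTheory.lintegral_const_mul' _ _ hct]
    exact MeasureTheory.setLIntegral_mono' hΩ fun y hy => hpt x hx y hy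
  exact h4.trans_lt (ENNReal.mul_lt_top hct.lt_top hd)

/-! ### The slit disc with the Euclidean distance -/

theorem segment_subset_sector_two_pi {x y : EuclideanSpace ℝ (Fin 2)}
    (hx : x ∈ sector (2 * Real.pi)) (hy : y ∈ sector (2 * Real.pi)) (h : 0 ≤ x 1 * y 1) :
    segment ℝ x y ⊆ sector (2 * Real.pi) := by
  rw [mem_sector_two_pi_iff] at hx hy
  rintro z ⟨s, t, hs, ht, hst, rfl⟩
  rw [mem_sector_two_pi_iff]
  constructor
  · rw [← mem_ball_zero_iff]
    exact (convex_ball (0 : EuclideanSpace ℝ (Fin 2)) 1) (mem_ball_zero_iff.2 hx.1)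
      (mem_ball_zero_iff.2 hy.1) hs ht hst
  · simp only [PiLp.add_apply, PiLp.smul_apply, smul_eq_mul]
    by_contra! hcon
    obtain ⟨h0, h1⟩ := hcon
    rcases hs.eq_or_lt with rfl | hs
    · obtain rfl : t = 1 := by linarith
      simp at h0 h1
      exact hy.2.elim (fun h => by linarith) (fun h => h h1)
    rcases ht.eq_or_lt with rfl | ht
    · obtain rfl : s = 1 := by linarith
      simp at h0 h1
      exact hx.2.elim (fun h => by linarith) (fun h => h h1)
    -- An interior point of the segment on the axis forces, without a sign change, both endpoints
    -- onto the axis, hence onto its negative half.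
    have h2 : s * x 1 ^ 2 + t * (x 1 * y 1) = 0 := by linear_combination x 1 * h1
    have h3 : s * (x 1 * y 1) + t * y 1 ^ 2 = 0 := by linear_combination y 1 * h1
    have hx1 : x 1 = 0 := by
      have : s * x 1 ^ 2 = 0 := by
        have := mul_nonneg ht.le h
        have := mul_nonneg hs.le (sq_nonneg (x 1))
        linarith
      simpa [hs.ne'] using this
    have hy1 : y 1 = 0 := by
      have : t * y 1 ^ 2 = 0 := by
        have := mul_nonneg hs.le h
        have := mul_nonneg ht.le (sq_nonneg (y 1))
        linarith
      simpa [ht.ne'] using this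
    have hx0 : x 0 < 0 := hx.2.resolve_right (by simp [hx1])
    have hy0 : y 0 < 0 := hy.2.resolve_right (by simp [hy1])
    have := mul_neg_of_pos_of_neg hs hx0
    have := mul_neg_of_pos_of_neg ht hy0
    linarith

theorem volume_coordinate_eq_zero (i : Fin 2) :
    MeasureTheory.volume {x : EuclideanSpace ℝ (Fin 2) | x i = 0} = 0 := by
  have h := MeasureTheory.Measure.addHaar_submodule
    (MeasureTheory.volume : MeasureTheory.Measure (EuclideanSpace ℝ (Fin 2)))
    (LinearMap.ker (PiLp.projₗ (𝕜 := ℝ) 2 (fun _ : Fin 2 => ℝ) i)) (fun h => by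
      have h1 : EuclideanSpace.single i (1 : ℝ) ∈
          LinearMap.ker (PiLp.projₗ (𝕜 := ℝ) 2 (fun _ : Fin 2 => ℝ) i) := by
        rw [h]
        trivial
      simp at h1)
  exact h

/-- Since `‖x‖` dominates both coordinates, splitting `2b = -a - c` bounds the function by `|x
0|^(-a) |x 1|^(-(c+q))`, a product of one-variable functions. -/
theorem integrableOn_norm_rpow_mul_rpow {b q : ℝ} (hb : b ≤ 0) (hq1 : q < 1)
    (hbq : -2 < 2 * b - q) :
    MeasureTheory.IntegrableOn
      (fun x : EuclideanSpace ℝ (Fin 2) => ‖x‖ ^ (2 * b) * |x 1| ^ (-q)) (Metric.ball 0 1) := by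
  -- With `c = a (1 - q)` one has `1 - (c + q) = (1 - a)(1 - q)`, so both exponents are below `1`
  -- once `a < 1`, which is the hypothesis `hbq`.
  set a : ℝ := -(2 * b) / (2 - q) with ha
  set c : ℝ := -(2 * b) * (1 - q) / (2 - q) with hc
  have ha0 : 0 ≤ a := div_nonneg (by linarith) (by linarith)
  have ha1 : a < 1 := by rw [ha, div_lt_one (by linarith)]; linarith
  have hca : c = a * (1 - q) := by rw [ha, hc]; ring
  have hc0 : 0 ≤ c := by rw [hca]; exact mul_nonneg ha0 (by linarith)
  have hc1 : c + q < 1 := by rw [hca]; nlinarith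
  have hsum : 2 * b = -a + -c := by
    have : (2 : ℝ) - q ≠ 0 := by linarith
    rw [ha, hc]
    field_simp
    ring
  have hint : ∀ p : ℝ, p < 1 → MeasureTheory.Integrable
      ((Metric.ball (0 : ℝ) 1).indicator fun s => |s| ^ (-p)) := by
    intro p hp
    rw [MeasureTheory.integrable_indicator_iff measurableSet_ball]
    refine MeasureTheory.integrableOn_ball_of_norm_le_rpow (C := 1) (α := p) (by simp)
      (by simpa using hp) ?_ ?_
    · filter_upwards with s
      rw [one_mul, Real.norm_eq_abs, Real.norm_eq_abs, abs_of_nonneg (by positivity)]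
    · exact (measurable_id.abs.pow_const _).aestronglyMeasurable
  have hprod := (hint a ha1).mul_prod (hint (c + q) hc1)
  have hpres := (MeasureTheory.volume_preserving_finTwoArrow ℝ).comp (PiLp.volume_preserving_ofLp (Fin 2))
  have hcomp := hpres.integrable_comp_of_integrable hprod
  have hm : Measurable fun x : EuclideanSpace ℝ (Fin 2) => x 1 := by fun_prop
  refine (hcomp.integrableOn (s := Metric.ball 0 1)).mono'
    ((measurable_norm.pow_const _).mul (hm.abs.pow_const _)).aestronglyMeasurable ?_
  have hne : ∀ i : Fin 2, ∀ᵐ x : EuclideanSpace ℝ (Fin 2)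
      ∂MeasureTheory.volume.restrict (Metric.ball 0 1), x i ≠ 0 := fun i =>
    MeasureTheory.ae_restrict_of_ae
      (MeasureTheory.measure_eq_zero_iff_ae_notMem.1 (volume_coordinate_eq_zero i))
  filter_upwards [hne 0, hne 1, MeasureTheory.ae_restrict_mem measurableSet_ball] with x h0 h1 hx
  rw [mem_ball_zero_iff] at hx
  have hle : ∀ i : Fin 2, |x i| ≤ ‖x‖ := fun i => PiLp.norm_apply_le x i
  have hmem : ∀ i : Fin 2, x i ∈ Metric.ball (0 : ℝ) 1 := fun i => by
    rw [mem_ball_zero_iff]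
    exact (hle i).trans_lt hx
  have e : ((fun z : ℝ × ℝ => (Metric.ball (0 : ℝ) 1).indicator (fun s => |s| ^ (-a)) z.1 *
      (Metric.ball (0 : ℝ) 1).indicator (fun s => |s| ^ (-(c + q))) z.2) ∘
      (MeasurableEquiv.finTwoArrow ∘ WithLp.ofLp)) x = |x 0| ^ (-a) * |x 1| ^ (-(c + q)) := by
    change (Metric.ball (0 : ℝ) 1).indicator (fun s => |s| ^ (-a)) (x 0) *
      (Metric.ball (0 : ℝ) 1).indicator (fun s => |s| ^ (-(c + q))) (x 1) = _
    rw [Set.indicator_of_mem (hmem 0), Set.indicator_of_mem (hmem 1)]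
  have hx0 : 0 < |x 0| := abs_pos.2 h0
  have hx1 : 0 < |x 1| := abs_pos.2 h1
  have hr : 0 < ‖x‖ := hx0.trans_le (hle 0)
  rw [e, Real.norm_of_nonneg (by positivity), hsum, Real.rpow_add hr, neg_add, Real.rpow_add hx1,
    ← mul_assoc]
  have e1 : ‖x‖ ^ (-a) ≤ |x 0| ^ (-a) := Real.rpow_le_rpow_of_nonpos hx0 (hle 0) (by linarith)
  have e2 : ‖x‖ ^ (-c) ≤ |x 1| ^ (-c) := Real.rpow_le_rpow_of_nonpos hx1 (hle 1) (by linarith)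
  gcongr

/-! ### Seminorms of `Re(z^β H)` and of smooth functions -/

theorem slobodeckijSq_congr
    (d : EuclideanSpace ℝ (Fin 2) → EuclideanSpace ℝ (Fin 2) → ℝ≥0∞)
    {Ω : Set (EuclideanSpace ℝ (Fin 2))} (hΩ : MeasurableSet Ω) (σ : ℝ)
    {v w : EuclideanSpace ℝ (Fin 2) → ℝ} (h : Set.EqOn v w Ω) :
    slobodeckijSq d Ω σ v = slobodeckijSq d Ω σ w :=
  MeasureTheory.setLIntegral_congr_fun hΩ fun x hx =>
    MeasureTheory.setLIntegral_congr_fun hΩ fun y hy => by simp only [h hx, h hy]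

theorem exists_bound_powMode_of_le {ω : ℝ} (hω : ω ≤ 2 * Real.pi) {β b : ℝ} (hb : b ≤ β)
    {H : EuclideanSpace ℝ (Fin 2) → ℂ} (hH : ContDiff ℝ (⊤ : ℕ∞) H) :
    ∃ C : ℝ, 0 ≤ C ∧ (∀ x ∈ sector ω, |powMode β H x| ≤ C * ‖x‖ ^ b) ∧
      ∀ x ∈ sector ω, ‖fderiv ℝ (powMode β H) x‖ ≤ C * ‖x‖ ^ (b - 1) := by
  obtain ⟨C, hC, h⟩ := exists_bound_powMode β hH
  have h1 : ∀ x ∈ sector ω, ‖x‖ ≤ 1 := fun x hx => (mem_ball_zero_iff.1 (sector_subset_ball ω hx)).le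
  have hs := sector_subset_slitDomain hω
  refine ⟨C, hC, fun x hx => (h x (hs hx) (h1 x hx)).1.trans ?_,
    fun x hx => (h x (hs hx) (h1 x hx)).2.trans ?_⟩
  · exact mul_le_mul_of_nonneg_left (Real.rpow_le_rpow_of_exponent_ge
      (norm_pos_of_mem_slitDomain (hs hx)) (h1 x hx) hb) hC
  · exact mul_le_mul_of_nonneg_left (Real.rpow_le_rpow_of_exponent_ge
      (norm_pos_of_mem_slitDomain (hs hx)) (h1 x hx) (by linarith)) hC

theorem differentiableAt_powMode (β : ℝ) {H : EuclideanSpace ℝ (Fin 2) → ℂ}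
    (hH : ContDiff ℝ (⊤ : ℕ∞) H) {x : EuclideanSpace ℝ (Fin 2)} (hx : x ∈ slitDomain) :
    DifferentiableAt ℝ (powMode β H) x :=
  (hasFDerivAt_powMode β hH hx).differentiableAt

theorem slobodeckijSq_innerEDist_powMode_lt_top {ω : ℝ} (hω : ω ≤ 2 * Real.pi) {β σ : ℝ}
    (hσ : 0 < σ) (hσ1 : σ < 1) (hσβ : σ < β + 1) {H : EuclideanSpace ℝ (Fin 2) → ℂ}
    (hH : ContDiff ℝ (⊤ : ℕ∞) H) :
    slobodeckijSq (innerEDist (sector ω)) (sector ω) σ (powMode β H) < ⊤ := by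
  -- Lowering the exponent weakens the bounds in the unit disc, and `b ≤ 0` secures `b ≤ 1` and `q ≤
  -- 2`.
  set b := min β 0 with hb
  have hbβ : b ≤ β := min_le_left _ _
  have hb0 : b ≤ 0 := min_le_right _ _
  have hσb : σ < b + 1 := by
    rcases min_cases β 0 with ⟨h, _⟩ | ⟨h, _⟩ <;> rw [hb, h] <;> linarith
  -- The lower bound on `q` makes `a = 2 + 2σ - q` less than `2`; the upper one makes `r^(2b-q)`
  -- integrable.
  obtain ⟨q, hq, hq2⟩ := exists_between (show 2 * σ < 2 * b + 2 by linarith)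
  obtain ⟨C, hC, h0, h1⟩ := exists_bound_powMode_of_le hω hbβ hH
  have hs := sector_subset_slitDomain hω
  have hΩ := isOpen_sector hω
  refine slobodeckijSq_lt_top (a := 2 + 2 * σ - q) (w := fun x => ‖x‖ ^ (2 * b - q))
    (C := 2 * C ^ 2 * 3 ^ q + (C * (1 / 2) ^ (b - 1)) ^ 2) hΩ.measurableSet (sector_subset_ball ω)
    (by linarith) (by positivity) (measurable_norm.pow_const _) (fun x => by positivity)
    ((integrableOn_ball_norm_rpow (by linarith) 1).mono_set (sector_subset_ball ω))
    fun x hx y hy => ?_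
  rcases eq_or_ne x y with rfl | hxy
  · simp
  exact enorm_sq_div_innerEDist_le hΩ (fun x hx => norm_pos_of_mem_slitDomain (hs hx))
    (fun z hz => differentiableAt_powMode β hH (hs hz)) (by linarith) hC h0 h1 (by linarith)
    (by linarith) (by linarith) (by ring) hσ hx hy hxy

theorem slobodeckijSq_edist_powMode_slit_lt_top {β σ : ℝ}
    (hσ : 0 < σ) (hσ1 : σ < 1 / 2) (hσβ : σ < β + 1) {H : EuclideanSpace ℝ (Fin 2) → ℂ}
    (hH : ContDiff ℝ (⊤ : ℕ∞) H) :
    slobodeckijSq edist (sector (2 * Real.pi)) σ (powMode β H) < ⊤ := by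
  set b := min β 0 with hb
  have hbβ : b ≤ β := min_le_left _ _
  have hb0 : b ≤ 0 := min_le_right _ _
  have hσb : σ < b + 1 := by
    rcases min_cases β 0 with ⟨h, _⟩ | ⟨h, _⟩ <;> rw [hb, h] <;> linarith
  -- The extra condition `q < 1`, possible as `σ < 1/2`, makes `|x 1|^(-q)` integrable across the
  -- slit.
  obtain ⟨q, hq, hq2⟩ := exists_between
    (show 2 * σ < min (2 * b + 2) 1 from lt_min (by linarith) (by linarith))
  obtain ⟨hqb, hq1⟩ := lt_min_iff.1 hq2
  obtain ⟨C, hC, h0, h1⟩ := exists_bound_powMode_of_le (le_refl (2 * Real.pi)) hbβ hH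
  have hs := sector_subset_slitDomain (le_refl (2 * Real.pi))
  have hΩ := isOpen_sector (le_refl (2 * Real.pi))
  have hpos : ∀ x ∈ sector (2 * Real.pi), 0 < ‖x‖ := fun x hx => norm_pos_of_mem_slitDomain (hs hx)
  have hm : Measurable fun x : EuclideanSpace ℝ (Fin 2) => x 1 := by fun_prop
  refine slobodeckijSq_lt_top (a := 2 + 2 * σ - q)
    (w := fun x => ‖x‖ ^ (2 * b - q) + ‖x‖ ^ (2 * b) * |x 1| ^ (-q))
    (C := 2 * C ^ 2 * 3 ^ q + (C * (1 / 2) ^ (b - 1)) ^ 2) hΩ.measurableSet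
    (sector_subset_ball _) (by linarith) (by positivity)
    ((measurable_norm.pow_const _).add ((measurable_norm.pow_const _).mul (hm.abs.pow_const _)))
    (fun x => by positivity)
    (((integrableOn_ball_norm_rpow (by linarith) 1).mono_set (sector_subset_ball _)).add
      ((integrableOn_norm_rpow_mul_rpow hb0 hq1 (by linarith)).mono_set
        (sector_subset_ball _)))
    fun x hx y hy => ?_
  rcases eq_or_ne x y with rfl | hxy
  · simp
  by_cases hsign : 0 ≤ x 1 * y 1
  · have hd : edist x y = innerEDist (sector (2 * Real.pi)) x y :=
      le_antisymm (edist_le_innerEDist _ x y)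
        (innerEDist_le_edist_of_segment (segment_subset_sector_two_pi hx hy hsign))
    rw [hd]
    refine (enorm_sq_div_innerEDist_le hΩ hpos
      (fun z hz => differentiableAt_powMode β hH (hs hz)) (by linarith) hC h0 h1
      (a := 2 + 2 * σ - q) (q := q) (by linarith)
      (by linarith) (by linarith) (by ring) hσ hx hy hxy).trans (ENNReal.ofReal_le_ofReal ?_)
    gcongr
    · exact le_add_of_nonneg_right (by positivity)
    · exact le_add_of_nonneg_right (by positivity)
  -- Opposite signs give `|x 1|, |y 1| ≤ ‖x - y‖`, so the crude bound applies with these as weights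
  -- in place of the norms.
  · rw [not_le] at hsign
    have hρ : 0 < ‖x - y‖ := norm_pos_iff.2 (sub_ne_zero.2 hxy)
    refine enorm_sq_div_rpow_le (by positivity) (edist_pos.2 hxy) fun _ => ?_
    rw [edist_dist, ENNReal.toReal_ofReal dist_nonneg, dist_eq_norm]
    have hcoord : |x 1 - y 1| ≤ ‖x - y‖ := PiLp.norm_apply_le (x - y) 1
    have hx1 : |x 1| ≤ |x 1 - y 1| := by
      refine sq_le_sq.1 ?_
      nlinarith [sq_nonneg (y 1)]
    have hy1 : |y 1| ≤ |x 1 - y 1| := by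
      refine sq_le_sq.1 ?_
      nlinarith [sq_nonneg (x 1)]
    have h3 : |powMode β H x - powMode β H y| ≤ C * ‖x‖ ^ b + C * ‖y‖ ^ b :=
      (abs_sub _ _).trans (add_le_add (h0 x hx) (h0 y hy))
    have h4 := sq_le_of_crude_bound (a := 2 + 2 * σ - q) (q := q) (by linarith) (by linarith) hρ
      le_rfl (hpos x hx) (hpos y hy) (A := |x 1|) (A' := |y 1|)
      (abs_pos.2 fun h => by simp [h] at hsign) (abs_pos.2 fun h => by simp [h] at hsign)
      (by linarith) (by linarith) h3
    rw [sub_add_cancel] at h4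
    refine h4.trans ?_
    gcongr
    · exact le_add_of_nonneg_right (by positivity)
    · exact le_add_of_nonneg_left (by positivity)
    · exact le_add_of_nonneg_left (by positivity)

/-- A Lipschitz bound on the closed disc leaves the kernel `‖x - y‖^(-2σ)`, integrable as `σ < 1`.
-/
theorem slobodeckijSq_edist_lt_top_of_contDiff {Ω : Set (EuclideanSpace ℝ (Fin 2))}
    (hΩ : MeasurableSet Ω) (hb : Ω ⊆ Metric.ball 0 1) {σ : ℝ} (hσ : 0 < σ) (hσ1 : σ < 1)
    {v : EuclideanSpace ℝ (Fin 2) → ℝ} (hv : ContDiff ℝ (⊤ : ℕ∞) v) :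
    slobodeckijSq edist Ω σ v < ⊤ := by
  obtain ⟨L, hL⟩ := (isCompact_closedBall (0 : EuclideanSpace ℝ (Fin 2)) 1).exists_bound_of_continuousOn
    (hv.continuous_fderiv (by simp)).continuousOn
  have hL0 : 0 ≤ L := (norm_nonneg _).trans (hL 0 (by simp))
  refine slobodeckijSq_lt_top (a := 2 * σ) (w := fun _ => 1) (C := L ^ 2) hΩ hb
    (by linarith) (by positivity) measurable_const (fun _ => zero_le_one)
    (MeasureTheory.integrableOn_const
      ((MeasureTheory.measure_mono hb).trans_lt MeasureTheory.measure_ball_lt_top).ne)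
    fun x hx y hy => ?_
  rcases eq_or_ne x y with rfl | hxy
  · simp
  have hρ : 0 < ‖x - y‖ := norm_pos_iff.2 (sub_ne_zero.2 hxy)
  refine enorm_sq_div_rpow_le (by positivity) (edist_pos.2 hxy) fun _ => ?_
  rw [edist_dist, ENNReal.toReal_ofReal dist_nonneg, dist_eq_norm]
  have h1 : |v x - v y| ≤ L * ‖x - y‖ :=
    (convex_closedBall (0 : EuclideanSpace ℝ (Fin 2)) 1).norm_image_sub_le_of_norm_fderiv_le
      (𝕜 := ℝ) (fun z _ => hv.differentiable (by simp) z) hL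
      (Metric.ball_subset_closedBall (hb hy)) (Metric.ball_subset_closedBall (hb hx))
  have h2 : ‖x - y‖ ^ (-(2 * σ)) * ‖x - y‖ ^ (2 + 2 * σ) = ‖x - y‖ ^ 2 := by
    rw [← Real.rpow_add hρ, ← Real.rpow_two]
    congr 1
    ring
  calc (v x - v y) ^ 2 = |v x - v y| ^ 2 := (sq_abs _).symm
    _ ≤ (L * ‖x - y‖) ^ 2 := by gcongr
    _ = L ^ 2 * (‖x - y‖ ^ (-(2 * σ)) * ‖x - y‖ ^ (2 + 2 * σ)) := by rw [h2, mul_pow]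
    _ ≤ 2 * (L ^ 2 * (‖x - y‖ ^ (-(2 * σ)) * ‖x - y‖ ^ (2 + 2 * σ))) := by
      linarith [show 0 ≤ L ^ 2 * (‖x - y‖ ^ (-(2 * σ)) * ‖x - y‖ ^ (2 + 2 * σ)) by positivity]
    _ = _ := by ring

theorem branchPow_natCast (n : ℕ) {x : EuclideanSpace ℝ (Fin 2)} (hx : x ∈ slitDomain) :
    branchPow n x = toComplex x ^ n := by
  induction n with
  | zero => simp [branchPow]
  | succ n ih =>
    rw [← branchPow_sub_one_mul _ hx, Nat.cast_succ, add_sub_cancel_right, ih, pow_succ]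

/-! ### Sobolev regularity of the eigenmode -/

theorem exists_iterate_eigenmode_eq {ν μ : ℝ} (hν : 0 ≤ ν) (hμ : 0 < μ) (α : Fin 2 → ℕ) :
    ∃ H : EuclideanSpace ℝ (Fin 2) → ℂ, ContDiff ℝ (⊤ : ℕ∞) H ∧
      Set.EqOn ((partialDeriv 1)^[α 1] ((partialDeriv 0)^[α 0] (eigenmode ν μ)))
        (powMode (ν - α 0 - α 1) H) slitDomain := by
  have h0 : ContDiff ℝ (⊤ : ℕ∞) fun x => (besselProfile ν μ x : ℂ) :=
    Complex.ofRealCLM.contDiff.comp (contDiff_besselProfile hν μ)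
  obtain ⟨H₁, hH₁, h₁⟩ := exists_partialDeriv_iterate_powMode 0 (α 0) ν h0
  obtain ⟨H₂, hH₂, h₂⟩ := exists_partialDeriv_iterate_powMode 1 (α 1) (ν - α 0) hH₁
  refine ⟨H₂, hH₂, (partialDeriv_iterate_congr isOpen_slitDomain 1 _ ?_).trans h₂⟩
  exact (partialDeriv_iterate_congr isOpen_slitDomain 0 _ (eigenmode_eqOn hμ)).trans h₁

theorem memSobolev_eigenmode {d : EuclideanSpace ℝ (Fin 2) → EuclideanSpace ℝ (Fin 2) → ℝ≥0∞}
    {ω ν μ s : ℝ} (hω : ω ≤ 2 * Real.pi) (hν : 0 ≤ ν) (hμ : 0 < μ) (hs : 0 ≤ s) (hs' : s < ν + 1)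
    (h : ∀ α : Fin 2 → ℕ, α 0 + α 1 = ⌊s⌋₊ → (⌊s⌋₊ : ℝ) < s →
      slobodeckijSq d (sector ω) (s - ⌊s⌋₊)
        ((partialDeriv 1)^[α 1] ((partialDeriv 0)^[α 0] (eigenmode ν μ))) < ⊤) :
    MemSobolev d (sector ω) s (eigenmode ν μ) := by
  have hΩ := isOpen_sector hω
  have hsub := sector_subset_slitDomain hω
  have hu : ContDiffOn ℝ (⊤ : ℕ∞) (eigenmode ν μ) (sector ω) :=
    ((contDiffOn_powMode ν (Complex.ofRealCLM.contDiff.comp (contDiff_besselProfile hν μ))).congr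
      (eigenmode_eqOn hμ)).mono hsub
  refine ⟨fun α => (partialDeriv 1)^[α 1] ((partialDeriv 0)^[α 0] (eigenmode ν μ)), fun α hα =>
    ⟨isWeakDeriv_of_contDiffOn hΩ α hu, ?_, h α⟩⟩
  obtain ⟨H, hH, hEq⟩ := exists_iterate_eigenmode_eq hν hμ α
  obtain ⟨C, hC, h0, -⟩ := exists_bound_powMode_of_le hω le_rfl hH
  have hα' : (α 0 : ℝ) + α 1 ≤ s := by
    have h1 : ((α 0 + α 1 : ℕ) : ℝ) ≤ ⌊s⌋₊ := by exact_mod_cast hα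
    push_cast at h1
    exact h1.trans (Nat.floor_le hs)
  refine memLp_two_of_le_norm_rpow hΩ.measurableSet (sector_subset_ball ω)
    (contDiffOn_partialDeriv_iterate hΩ 1 _
      (contDiffOn_partialDeriv_iterate hΩ 0 _ hu)).continuousOn (b := ν - α 0 - α 1) (C := C)
    (by linarith) fun x hx => ?_
  beta_reduce
  rw [hEq (hsub hx)]
  exact h0 x hx

end

theorem lemma1 (ω : ℝ) (hω : 0 < ω) (hω' : ω ≤ 2 * Real.pi) (k m : ℕ) (hm : 1 ≤ m)
    (ν μ : ℝ) (hν : ν = k * (Real.pi / ω)) (hμ : IsBesselZero ν m μ)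
    (s : ℝ) (hs : 0 ≤ s) (hs' : s < ν + 1) :
    (ω < 2 * Real.pi ∨ Even k ∨ s - ⌊s⌋₊ < 1 / 2 →
      MemSobolev edist (sector ω) s (eigenmode ν μ)) ∧
    MemSobolev (innerEDist (sector ω)) (sector ω) s (eigenmode ν μ) := by
  have hν0 : 0 ≤ ν := by rw [hν]; positivity
  have hμ0 := hμ.1
  have hΩ := isOpen_sector hω'
  have hsub := sector_subset_slitDomain hω'
  have hσ1 : s - ⌊s⌋₊ < 1 := by linarith [Nat.lt_floor_add_one s]
  -- With `β = ν - ⌊s⌋` this is exactly `s < ν + 1`.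
  have hσβ : ∀ α : Fin 2 → ℕ, α 0 + α 1 = ⌊s⌋₊ → s - ⌊s⌋₊ < ν - α 0 - α 1 + 1 := by
    intro α hα
    rw [← hα]
    push_cast
    linarith
  have hinner : ∀ α : Fin 2 → ℕ, α 0 + α 1 = ⌊s⌋₊ → (⌊s⌋₊ : ℝ) < s →
      slobodeckijSq (innerEDist (sector ω)) (sector ω) (s - ⌊s⌋₊)
        ((partialDeriv 1)^[α 1] ((partialDeriv 0)^[α 0] (eigenmode ν μ))) < ⊤ := by
    intro α hα hlt
    obtain ⟨H, hH, hEq⟩ := exists_iterate_eigenmode_eq hν0 hμ0 α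
    rw [slobodeckijSq_congr _ hΩ.measurableSet _ (hEq.mono hsub)]
    exact slobodeckijSq_innerEDist_powMode_lt_top hω' (by linarith) hσ1 (hσβ α hα) hH
  refine ⟨fun hcase => memSobolev_eigenmode hω' hν0 hμ0 hs hs' fun α hα hlt => ?_,
    memSobolev_eigenmode hω' hν0 hμ0 hs hs' hinner⟩
  rcases hω'.lt_or_eq with hlt2 | heq
  · obtain ⟨K, hK, hle⟩ := exists_innerEDist_le_mul_edist hω hlt2
    exact slobodeckijSq_lt_top_of_le_mul hΩ.measurableSet (by linarith) hK hle (hinner α hα hlt)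
  subst heq
  rcases hcase with h | ⟨N, hN⟩ | h
  · exact absurd h (lt_irrefl _)
  -- Here `k = 2N` and `ω = 2π`, so `ν = N` is an integer and the eigenmode extends smoothly across
  -- the slit.
  · have hνN : ν = N := by
      rw [hν, hN]
      push_cast
      field_simp
      ring
    have hU : ContDiff ℝ (⊤ : ℕ∞) fun x => (toComplex x ^ N * (besselProfile ν μ x : ℂ)).re :=
      Complex.reCLM.contDiff.comp ((toComplex.contDiff.pow N).mul
        (Complex.ofRealCLM.contDiff.comp (contDiff_besselProfile hν0 μ)))
    have hEq : Set.EqOn (eigenmode ν μ)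
        (fun x => (toComplex x ^ N * (besselProfile ν μ x : ℂ)).re) (sector (2 * Real.pi)) := by
      intro x hx
      rw [eigenmode_eqOn hμ0 (hsub hx), powMode, hνN, branchPow_natCast N (hsub hx)]
    rw [slobodeckijSq_congr _ hΩ.measurableSet _ (partialDeriv_iterate_congr hΩ 1 _
      (partialDeriv_iterate_congr hΩ 0 _ hEq))]
    exact slobodeckijSq_edist_lt_top_of_contDiff hΩ.measurableSet (sector_subset_ball _)
      (by linarith) hσ1 (contDiff_partialDeriv_iterate 1 _ (contDiff_partialDeriv_iterate 0 _ hU))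
  · obtain ⟨H, hH, hEq⟩ := exists_iterate_eigenmode_eq hν0 hμ0 α
    rw [slobodeckijSq_congr _ hΩ.measurableSet _ (hEq.mono hsub)]
    exact slobodeckijSq_edist_powMode_slit_lt_top (by linarith) h (hσβ α hα) hH
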